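/- **Setting.** For each $n$ consider the random fully connected network of width $n$ and depth $T_n$ on $\{-1,1\}^n$: given weight matrices $\Theta=(\theta_1,\dots,\theta_{T_n})$, $\theta_t\in\mathbb{R}^{n\times n}$, and an input $\omega=\omega_0\in\{-1,1\}^n$, put $\omega_t=\mathrm{sign}(\theta_t\omega_{t-1})$ (pointwise) for $t=1,\dots,T_n$, and $f_{n,T_n}(\omega)=h_n(\omega_{T_n})$, where $h_n:\{-1,1\}^n\to\{-1,1\}$ is given. The $\theta_t$ are independent, and the columns of each $\theta_t$ are independent centred Gaussian vectors in $\mathbb{R}^n$ whose entries have variance $1$ and pairwise correlation $\rho=\rho_n$; that is, $\theta_t(i,j)=\sqrt{\rho_n}\,\nu_t(j)+\sqrt{1-\rho_n}\,\psi_t(i,j)$ with all $\nu_t(j),\psi_t(i,j)$ independent standard Gaussians. The function $h_n$ is odd if $h_n(-x)=-h_n(x)$ for all $x$. The sequence $\{h_n\}$ has a sharp threshold at $1/2$ if for all $p_n\in[0,1]$ with $\inf_n|p_n-1/2|>0$ one has $\mathrm{P}(h_n(X)=\mathrm{sign}(p_n-1/2))\to1$ as $n\to\infty$, where $X\in\{-1,1\}^n$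 has independent coordinates equal to $1$ with probability $p_n$ and to $-1$ with probability $1-p_n$. **Theorem.** There is a sequence $S_n$ of natural numbers such that the following holds. Suppose that for some $\delta>0$ independent of $n$, for all large $n$, $$\delta<\rho_n<1-\frac{4(\log\log n)^3}{\log n},\qquad T_n\ge e^{4(\log\log n)^2},$$ that $h_n$ is odd for all large $n$, and that either $\{h_n\}$ has a sharp threshold at $1/2$, or $T_n\ge S_n$ for all large $n$. Then: (i) For any $\omega^{(n)},\eta^{(n)}\in\{-1,1\}^n$ with $\eta^{(n)}\notin\{\omega^{(n)},-\omega^{(n)}\}$ for all large $n$, $$\lim_{n\to\infty}\mathrm{Cov}_\Theta\bigl(f_{n,T_n}(\omega^{(n)}),f_{n,T_n}(\eta^{(n)})\bigr)=0 .$$ (ii) For any probability measures $\mathbf{Q}_n$ on $\{-1,1\}^n\times\{-1,1\}^n$ with $\mathbf{Q}_n(\eta\in\{\omega,-\omega\})\to0$, if $(\omega,\eta)\sim\mathbf{Q}_n$ is independent of $\Theta$, then $$\lim_{n\to\infty}\mathrm{Cov}_{\mathbf{Q}_n,\Theta}\bigl(f_{n,T_n}(\omega),f_{n,T_n}(\eta)\bigr)=0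 .$$ (iii) Let $k_n\in\{1,\dots,n-1\}$ for all large $n$ (for instance $k_n=k$ constant), let $\omega^{(n)}\in\{-1,1\}^n$ and $\gamma>0$, and let $M_{k_n}$ be the number of $\eta\in\{-1,1\}^n$ that differ from $\omega^{(n)}$ in exactly $k_n$ coordinates and satisfy $f_{n,T_n}(\eta)\ne f_{n,T_n}(\omega^{(n)})$. Then $$\lim_{n\to\infty}\mathrm{P}\left(\frac{M_{k_n}}{\binom{n}{k_n}}\notin\left(\frac{1-\gamma}{2},\frac{1+\gamma}{2}\right)\right)=0 .$$ -/

import Mathlib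

open MeasureTheory ProbabilityTheory Filter Topology

noncomputable section

namespace BoolNet

/-- The Boolean cube `{-1, 1}^n`; the units of `ℤ` are exactly `1` and `-1`. -/
abbrev Cube (n : ℕ) : Type := Fin n → ℤˣ

/-- The sign of a real number, with values in `{-1, 1}`. The value at `0` is a convention:
the argument vanishes with probability zero wherever weights are drawn at random. -/
def sgn (x : ℝ) : ℤˣ := if 0 ≤ x then 1 else -1

/-- One layer of the network: `x ↦ sign (W x)`, the sign being taken pointwise. -/
def layer {n : ℕ} (W : Fin n → Fin n → ℝ) (x : Cube n) : Cube n :=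
  fun i => sgn (∑ j, W i j * (((x j : ℤˣ) : ℤ) : ℝ))

/-- The vector `ω_T` obtained from `ω_0 = x` by `ω_t = sign (θ_t ω_{t-1})`, `t = 1, …, T`;
the matrix `θ_t` is `θ (t - 1)` here. -/
def hiddenState {n : ℕ} : (T : ℕ) → (Fin T → Fin n → Fin n → ℝ) → Cube n → Cube n
  | 0, _, x => x
  | T + 1, θ, x => layer (θ (Fin.last T)) (hiddenState T (fun t => θ t.castSucc) x)

/-- The Boolean function `f(x) = h(ω_T)` computed by the network with weights `θ`. -/
def net {n T : ℕ} (h : Cube n → ℤˣ) (θ : Fin T → Fin n → Fin n → ℝ) (x : Cube n) : ℤˣ :=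
  h (hiddenState T θ x)

/-- The output of the network as a real number, `1` or `-1`. -/
def netReal {n T : ℕ} (h : Cube n → ℤˣ) (θ : Fin T → Fin n → Fin n → ℝ) (x : Cube n) : ℝ :=
  ((net h θ x : ℤ) : ℝ)

/-- The law of one weight matrix `W(i, j) = √ρ ν(j) + √(1 - ρ) ψ(i, j)`, where all `ν(j)` and
`ψ(i, j)` are independent standard Gaussians. For `0 ≤ ρ ≤ 1` the columns of `W` are independent
centred Gaussian vectors with unit variances and all correlations equal to `ρ`. -/
def layerLaw (n : ℕ) (ρ : ℝ) : Measure (Fin n → Fin n → ℝ) :=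
  ((Measure.pi fun _ : Fin n => gaussianReal 0 1).prod
    (Measure.pi fun _ : Fin n => Measure.pi fun _ : Fin n => gaussianReal 0 1)).map
    (fun p i j => √ρ * p.1 j + √(1 - ρ) * p.2 i j)

/-- The law of the weights `Θ = (θ_1, …, θ_T)`: independent matrices with law `layerLaw n ρ`. -/
def weightLaw (n T : ℕ) (ρ : ℝ) : Measure (Fin T → Fin n → Fin n → ℝ) :=
  Measure.pi fun _ : Fin T => layerLaw n ρ

/-- The law on the cube under which the coordinates are independent, equal to `1` with
probability `p` and to `-1` with probability `1 - p`. -/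
def biasedLaw (n : ℕ) (p : ℝ) : Measure (Cube n) :=
  Measure.pi fun _ : Fin n =>
    ENNReal.ofReal p • Measure.dirac (1 : ℤˣ) + ENNReal.ofReal (1 - p) • Measure.dirac (-1 : ℤˣ)

/-- The sequence `h` has a sharp threshold at `1/2`. -/
def HasSharpThreshold (h : ∀ n : ℕ, Cube n → ℤˣ) : Prop :=
  ∀ p : ℕ → ℝ, (∀ n, 0 ≤ p n ∧ p n ≤ 1) → (∃ γ > 0, ∀ n, γ ≤ |p n - 1 / 2|) →
    Tendsto (fun n => (biasedLaw n (p n)).real {x | h n x = sgn (p n - 1 / 2)}) atTop (𝓝 1)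

/-- The number `M_k(x)` of points `y` at Hamming distance exactly `k` from `x` at which the output
of the network differs from its output at `x`. -/
def flipCount {n T : ℕ} (h : Cube n → ℤˣ) (θ : Fin T → Fin n → Fin n → ℝ) (x : Cube n)
    (k : ℕ) : ℕ :=
  (Finset.univ.filter fun y : Cube n => hammingDist x y = k ∧ net h θ y ≠ net h θ x).card

end BoolNet

end

/-!
The rows of a layer act on two inputs through Gaussian pairs whose law depends only on the Hamming
distance, so the distance between the images of two inputs performs a Markov chain on `{0, …, n}`.
Driving the chain from all starting points by the same Gaussian pairs couples
it monotonically, and it commutes with `d ↦ n - d` because almost surely a layer maps `-x` to the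
opposite of the image of `x`. Reflecting at the middle therefore bounds the expectation after `t`
steps of any odd antitone function with values in `[-1, 1]` by the probability that the chain from
`1` stays below `n / 2` for `t` steps.

This probability tends to `0`. A step typically takes `d` to the order of `√(d n)`, so about
`log (log n)` steps bring the chain to the order of `n`, and from there the common noise throws it
beyond `n / 2` with probability bounded below. By monotonicity an attempt that fails may be
restarted from `1`, provided that the two inputs have not merged, and the upper bound on `ρ` makes
merging unlikely throughout enough attempts.

The correlation of the outputs is close to an odd antitone function of the distance: under a sharp
threshold `h` applied to a last layer is nearly the sign of the inner product of that layer's input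
with the common noise, and without one a very deep network has absorbed the distance in `{0, n}`.
So outputs at inputs that are neither equal nor opposite are uniformly almost uncorrelated, which
gives (i) and (ii), and (iii) by Chebyshev's inequality on the Hamming sphere.
-/

noncomputable section

namespace BoolNet

section MarkovOperators

variable {α : Type*}

/-- Transition operators of Markov chains on `α`, acting on real functions: positive linear
operators that fix the constant function `1`. -/
structure IsMarkov (P : Module.End ℝ (α → ℝ)) : Prop where
  monotone : Monotone P
  map_one : P 1 = 1

/-- The probability that the chain with transition operator `P` is in `A` at each of the times
`0, …, t`, as a function of the starting point. -/
def survival (P : Module.End ℝ (α → ℝ)) (A : Set α) : ℕ → α → ℝ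
  | 0 => A.indicator 1
  | t + 1 => A.indicator (P (survival P A t))

variable {P : Module.End ℝ (α → ℝ)} {A : Set α}

namespace IsMarkov

lemma one : IsMarkov (1 : Module.End ℝ (α → ℝ)) := ⟨monotone_id, rfl⟩

lemma mul {Q : Module.End ℝ (α → ℝ)} (hP : IsMarkov P) (hQ : IsMarkov Q) : IsMarkov (P * Q) :=
  ⟨hP.monotone.comp hQ.monotone, by rw [Module.End.mul_apply, hQ.map_one, hP.map_one]⟩

lemma pow (hP : IsMarkov P) : ∀ t, IsMarkov (P ^ t)
  | 0 => by simpa using one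
  | t + 1 => by simpa only [pow_succ] using (hP.pow t).mul hP

lemma map_nonneg (hP : IsMarkov P) {f : α → ℝ} (hf : 0 ≤ f) : 0 ≤ P f := by
  simpa using hP.monotone hf

lemma map_const (hP : IsMarkov P) (c : ℝ) : P (fun _ => c) = fun _ => c := by
  have h := P.map_smul c 1
  rw [hP.map_one] at h
  convert h using 2 <;> simp [Pi.smul_def]

lemma map_le_one (hP : IsMarkov P) {f : α → ℝ} (hf : f ≤ 1) : P f ≤ 1 :=
  (hP.monotone hf).trans_eq hP.map_one

lemma abs_sub_le (hP : IsMarkov P) {f g u : α → ℝ} (h : ∀ x, |f x - g x| ≤ u x) (x : α) :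
    |P f x - P g x| ≤ P u x := by
  have h1 : P f ≤ P (g + u) := hP.monotone fun y => by
    have := (abs_le.1 (h y)).2
    rw [Pi.add_apply]; linarith
  have h2 : P g ≤ P (f + u) := hP.monotone fun y => by
    have := (abs_le.1 (h y)).1
    rw [Pi.add_apply]; linarith
  have h1x := h1 x
  have h2x := h2 x
  rw [map_add, Pi.add_apply] at h1x h2x
  exact abs_le.2 ⟨by linarith, by linarith⟩

lemma abs_le_one (hP : IsMarkov P) {f : α → ℝ} (hf : ∀ x, |f x| ≤ 1) (x : α) : |P f x| ≤ 1 := by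
  simpa [hP.map_const] using hP.abs_sub_le (g := 0) (u := fun _ => 1) (by simpa using hf) x

lemma survival_nonneg (hP : IsMarkov P) : ∀ t, 0 ≤ survival P A t
  | 0 => Set.indicator_nonneg fun _ _ => zero_le_one
  | t + 1 => Set.indicator_nonneg fun x _ => hP.map_nonneg (hP.survival_nonneg t) x

lemma survival_le_one (hP : IsMarkov P) : ∀ t, survival P A t ≤ 1
  | 0 => Set.indicator_le_self' fun _ _ => zero_le_one
  | t + 1 => Set.indicator_le' (fun x _ => hP.map_le_one (hP.survival_le_one t) x)
      fun _ _ => zero_le_one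

lemma survival_succ_le (hP : IsMarkov P) (t : ℕ) : survival P A (t + 1) ≤ P (survival P A t) :=
  Set.indicator_le_self' fun x _ => hP.map_nonneg (hP.survival_nonneg t) x

lemma survival_antitone_time (hP : IsMarkov P) : Antitone (survival P A) := by
  refine antitone_nat_of_succ_le fun t => ?_
  induction t with
  | zero => exact Set.indicator_mono (hP.map_le_one (hP.survival_le_one 0))
  | succ t ih => exact Set.indicator_mono (hP.monotone ih)

lemma survival_le_of_levels (hP : IsMarkov P) {L : ℕ → Set α} {p q : ℝ} (hp : 0 ≤ p) (hq : 0 ≤ q)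
    (hexit : ∀ x ∈ L 0, q ≤ P (Aᶜ.indicator 1) x) (k : ℕ)
    (hclimb : ∀ i < k, ∀ x ∈ L (i + 1), p ≤ P ((L i).indicator 1) x) :
    ∀ x ∈ L k, survival P A (k + 1) x ≤ 1 - p ^ k * q := by
  induction k with
  | zero =>
    intro x hx
    have hle : survival P A 1 x ≤ P (A.indicator 1) x := hP.survival_succ_le 0 x
    have hsum : P (A.indicator 1) x + P (Aᶜ.indicator 1) x = 1 := by
      rw [← Pi.add_apply, ← map_add, Set.indicator_self_add_compl, hP.map_one, Pi.one_apply]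
    linarith [hexit x hx]
  | succ k ih =>
    intro x hx
    have hdrop : survival P A (k + 1) + (p ^ k * q) • (L k).indicator 1 ≤ 1 := fun y => by
      by_cases hy : y ∈ L k
      · simpa [hy, le_sub_iff_add_le] using ih (fun i hi => hclimb i (hi.trans k.lt_succ_self)) y hy
      · simpa [hy] using hP.survival_le_one (k + 1) y
    have hle := hP.map_le_one hdrop x
    rw [map_add, map_smul, Pi.add_apply, Pi.smul_apply, smul_eq_mul, Pi.one_apply] at hle
    have hL := mul_le_mul_of_nonneg_left (hclimb k k.lt_succ_self x hx)
      (mul_nonneg (pow_nonneg hp k) hq)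
    have hsucc := hP.survival_succ_le (A := A) (k + 1) x
    calc survival P A (k + 1 + 1) x ≤ 1 - p ^ k * q * p := by linarith
      _ = 1 - p ^ (k + 1) * q := by ring

lemma pow_apply_le_smul (hP : IsMarkov P) {f : α → ℝ} {c : ℝ} (hc : 0 ≤ c) (hf : P f ≤ c • f)
    (t : ℕ) : (P ^ t) f ≤ c ^ t • f := by
  induction t with
  | zero => simp
  | succ t ih =>
    calc (P ^ (t + 1)) f = (P ^ t) (P f) := by rw [pow_succ, Module.End.mul_apply]
      _ ≤ (P ^ t) (c • f) := (hP.pow t).monotone hf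
      _ = c • (P ^ t) f := map_smul _ c f
      _ ≤ c • c ^ t • f := smul_le_smul_of_nonneg_left ih hc
      _ = c ^ (t + 1) • f := by rw [smul_smul, pow_succ']

end IsMarkov

lemma antitone_indicator [Preorder α] {f : α → ℝ} (hf : Antitone f) (h0 : 0 ≤ f)
    (hA : IsLowerSet A) : Antitone (A.indicator f) := fun x y hxy => by
  by_cases hy : y ∈ A
  · simpa [hy, hA hxy hy] using hf hxy
  · simpa [hy] using Set.indicator_nonneg (fun z _ => h0 z) x

section StochasticMonotonicity

/-- The chain preserves the stochastic order of its starting points. -/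
def IsStochasticallyMonotone [Preorder α] (P : Module.End ℝ (α → ℝ)) : Prop :=
  ∀ ⦃g : α → ℝ⦄, Antitone g → Antitone (P g)

lemma survival_antitone [Preorder α] (hP : IsMarkov P) (hmono : IsStochasticallyMonotone P)
    (hA : IsLowerSet A) : ∀ t, Antitone (survival P A t)
  | 0 => antitone_indicator antitone_const zero_le_one hA
  | t + 1 => antitone_indicator (hmono (survival_antitone hP hmono hA t))
      (hP.map_nonneg (hP.survival_nonneg t)) hA

section Renewal

variable [LinearOrder α] (hP : IsMarkov P) (hmono : IsStochasticallyMonotone P)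
  (hA : IsLowerSet A) (s : α)

include hP hmono hA

/-- Restart the chain from the lowest admissible point `s` at time `k`, unless it has fallen below
`s` by then. -/
lemma survival_add_le (t k : ℕ) :
    ∀ x, s ≤ x → survival P A (t + k) x ≤
      survival P A t s * survival P A k x + k * P ((Set.Iio s).indicator 1) s := by
  set merge := P ((Set.Iio s).indicator 1) s
  have hmerge : 0 ≤ merge := hP.map_nonneg (Set.indicator_nonneg fun _ _ => zero_le_one) s
  have hs : 0 ≤ survival P A t s := hP.survival_nonneg t s
  induction k with
  | zero =>
    intro x hx
    by_cases hxA : x ∈ A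
    · simpa [survival, hxA] using survival_antitone hP hmono hA t hx
    · cases t <;> simp [survival, hxA]
  | succ k ih =>
    intro x hx
    by_cases hxA : x ∈ A
    swap
    · simpa [survival, ← add_assoc, hxA] using mul_nonneg (by positivity) hmerge
    have hle : survival P A (t + k) ≤ survival P A t s • survival P A k +
        ((Set.Iio s).indicator 1 + fun _ => k * merge) := fun y => by
      simp only [Pi.add_apply, Pi.smul_apply, smul_eq_mul]
      rcases lt_or_ge y s with hy | hy
      · have h1 : survival P A (t + k) y ≤ 1 := hP.survival_le_one (t + k) y
        have h2 := mul_nonneg hs (hP.survival_nonneg (A := A) k y)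
        have h3 : 0 ≤ k * merge := by positivity
        simp only [Set.mem_Iio, hy, Set.indicator_of_mem, Pi.one_apply]
        linarith
      · simpa [hy.not_gt] using ih y hy
    have hstep := hP.monotone hle x
    simp only [map_add, map_smul, hP.map_const, Pi.add_apply, Pi.smul_apply, smul_eq_mul] at hstep
    have hx' : P ((Set.Iio s).indicator 1) x ≤ merge :=
      hmono (antitone_indicator antitone_const zero_le_one (isLowerSet_Iio s)) hx
    calc survival P A (t + (k + 1)) x = P (survival P A (t + k)) x := Set.indicator_of_mem hxA _
      _ ≤ survival P A t s * P (survival P A k) x +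
          (P ((Set.Iio s).indicator 1) x + k * merge) := hstep
      _ ≤ survival P A t s * survival P A (k + 1) x + (k + 1 : ℕ) * merge := by
        rw [survival, Set.indicator_of_mem hxA, Nat.cast_succ]
        linarith

lemma survival_mul_le (m k : ℕ) :
    survival P A (m * k) s ≤
      survival P A k s ^ m + m * k * P ((Set.Iio s).indicator 1) s := by
  set merge := P ((Set.Iio s).indicator 1) s
  have hmerge : 0 ≤ merge := hP.map_nonneg (Set.indicator_nonneg fun _ _ => zero_le_one) s
  have h0 : 0 ≤ survival P A k s := hP.survival_nonneg k s
  have h1 : survival P A k s ≤ 1 := hP.survival_le_one k s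
  induction m with
  | zero => simpa using hP.survival_le_one 0 s
  | succ m ih =>
    have hm : 0 ≤ m * k * merge := by positivity
    rw [Nat.succ_mul, Nat.cast_succ]
    calc survival P A (m * k + k) s
        ≤ survival P A (m * k) s * survival P A k s + k * merge :=
          survival_add_le hP hmono hA s (m * k) k s le_rfl
      _ ≤ (survival P A k s ^ m + m * k * merge) * survival P A k s + k * merge := by gcongr
      _ = survival P A k s ^ (m + 1) + m * k * merge * survival P A k s + k * merge := by ring
      _ ≤ survival P A k s ^ (m + 1) + (m + 1) * k * merge := by
        linarith [mul_le_of_le_one_right hm h1]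

end Renewal

section Reflection

variable {r : α → α} {g : α → ℝ} (hr : ∀ f : α → ℝ, P (f ∘ r) = P f ∘ r)
  (hodd : ∀ x, g (r x) = -g x)

include hr hodd in
lemma pow_apply_reflect (t : ℕ) (x : α) : (P ^ t) g (r x) = -(P ^ t) g x := by
  induction t generalizing x with
  | zero => simpa using hodd x
  | succ t ih =>
    have hneg : (P ^ t) g ∘ r = -(P ^ t) g := funext ih
    simp only [pow_succ', Module.End.mul_apply]
    rw [← Function.comp_apply (f := P _), ← hr, hneg, map_neg, Pi.neg_apply]

variable [LinearOrder α] (hP : IsMarkov P) (hmono : IsStochasticallyMonotone P) (hg : Antitone g)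

include hmono hg in
lemma antitone_pow_apply (t : ℕ) : Antitone ((P ^ t) g) := by
  induction t with
  | zero => simpa using hg
  | succ t ih => simpa only [pow_succ', Module.End.mul_apply] using hmono ih

include hP hmono hr hg hodd

/-- An antitone odd function is at most the indicator of the lower half `{x | x < r x}`. -/
lemma pow_apply_le_survival (hg1 : g ≤ 1) (t : ℕ) :
    (P ^ t) g ≤ survival P {x | x < r x} t := by
  have hupper : ∀ t x, ¬ x < r x → (P ^ t) g x ≤ 0 := fun t x hx => by
    have hle := antitone_pow_apply hmono hg t (not_lt.1 hx)
    rw [pow_apply_reflect hr hodd] at hle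
    linarith
  induction t with
  | zero =>
    intro x
    by_cases hx : x < r x
    · simpa [survival, hx] using hg1 x
    · simpa [survival, hx] using hupper 0 x hx
  | succ t ih =>
    intro x
    by_cases hx : x < r x
    · simpa [survival, hx, pow_succ'] using hP.monotone ih x
    · simpa [survival, hx] using hupper (t + 1) x hx

lemma abs_pow_apply_le_survival (hlower : IsLowerSet {x | x < r x}) (hg1 : g ≤ 1) (t : ℕ)
    {s x : α} (hx : s ≤ x) (hrx : s ≤ r x) :
    |(P ^ t) g x| ≤ survival P {x | x < r x} t s := by
  have hle : ∀ y, s ≤ y → (P ^ t) g y ≤ survival P {x | x < r x} t s := fun y hy =>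
    (pow_apply_le_survival hr hodd hP hmono hg hg1 t y).trans
      (survival_antitone hP hmono hlower t hy)
  refine abs_le'.2 ⟨hle x hx, ?_⟩
  rw [← pow_apply_reflect hr hodd]
  exact hle (r x) hrx

end Reflection

end StochasticMonotonicity

lemma pow_apply_comp {β : Type*} {Q : Module.End ℝ (β → ℝ)} {φ : α → β}
    (h : ∀ f : β → ℝ, P (f ∘ φ) = Q f ∘ φ) (t : ℕ) (f : β → ℝ) :
    (P ^ t) (f ∘ φ) = (Q ^ t) f ∘ φ := by
  induction t generalizing f with
  | zero => simp
  | succ t ih => rw [pow_succ, pow_succ, Module.End.mul_apply, Module.End.mul_apply, h, ih]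

end MarkovOperators

section RandomMaps

variable {Ξ α : Type*} [MeasurableSpace Ξ] [Finite α] [MeasurableSpace α]
  [MeasurableSingletonClass α] {μ : Measure Ξ} {φ : Ξ → α → α}

lemma integrable_comp_of_finite [IsFiniteMeasure μ] {X : Ξ → α} (hX : Measurable X) (g : α → ℝ) :
    Integrable (fun ξ => g (X ξ)) μ := by
  obtain ⟨C, hC⟩ := (Set.finite_range fun x => ‖g x‖).bddAbove
  exact .of_bound ((measurable_of_finite g).comp hX).aestronglyMeasurable C
    (ae_of_all _ fun ξ => hC ⟨X ξ, rfl⟩)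

/-- The transition operator of the Markov chain on a finite set which applies to each point an
independent copy of the random map `φ ξ`, where `ξ` has law `μ`. -/
def randomMapOp (μ : Measure Ξ) [IsProbabilityMeasure μ] (φ : Ξ → α → α)
    (hφ : ∀ x, Measurable fun ξ => φ ξ x) : Module.End ℝ (α → ℝ) where
  toFun g x := ∫ ξ, g (φ ξ x) ∂μ
  map_add' f g := funext fun x =>
    integral_add (integrable_comp_of_finite (hφ x) f) (integrable_comp_of_finite (hφ x) g)
  map_smul' c f := funext fun x => integral_const_mul c fun ξ => f (φ ξ x)

variable [IsProbabilityMeasure μ] {hφ : ∀ x, Measurable fun ξ => φ ξ x}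

lemma isMarkov_randomMapOp : IsMarkov (randomMapOp μ φ hφ) where
  monotone f g hfg x := integral_mono (integrable_comp_of_finite (hφ x) f)
    (integrable_comp_of_finite (hφ x) g) fun ξ => hfg (φ ξ x)
  map_one := funext fun x => by simp [randomMapOp]

lemma isStochasticallyMonotone_randomMapOp [Preorder α] (hmono : ∀ ξ, Monotone (φ ξ)) :
    IsStochasticallyMonotone (randomMapOp μ φ hφ) := fun g hg x y hxy =>
  integral_mono (integrable_comp_of_finite (hφ y) g) (integrable_comp_of_finite (hφ x) g)
    fun ξ => hg (hmono ξ hxy)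

lemma randomMapOp_indicator_one (s : Set α) (x : α) :
    randomMapOp μ φ hφ (s.indicator 1) x = μ.real {ξ | φ ξ x ∈ s} :=
  integral_indicator_one (hφ x s.toFinite.measurableSet)

end RandomMaps

section GaussianVectors

variable {ι : Type*} [Fintype ι]

/-- The functional `v ↦ ∑ i, v i * a i`. -/
def dotCLM (a : ι → ℝ) : (ι → ℝ) →L[ℝ] ℝ := ∑ i, a i • ContinuousLinearMap.proj i

lemma dotCLM_apply (a v : ι → ℝ) : dotCLM a v = ∑ i, v i * a i := by
  simp [dotCLM, mul_comm]

lemma dotCLM_add (a b : ι → ℝ) : dotCLM (a + b) = dotCLM a + dotCLM b := by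
  simp [dotCLM, add_smul, Finset.sum_add_distrib]

lemma dotCLM_neg (a : ι → ℝ) : dotCLM (-a) = -dotCLM a := by
  ext v
  simp [dotCLM_apply]

@[fun_prop]
lemma measurable_dotCLM (a : ι → ℝ) : Measurable (dotCLM a) := (dotCLM a).measurable

/-- The law of a standard Gaussian vector indexed by `ι`. -/
abbrev stdGaussianPi (ι : Type*) [Fintype ι] : Measure (ι → ℝ) :=
  Measure.pi fun _ => gaussianReal 0 1

/-- The standard Gaussian measure on the plane. -/
abbrev gauss2 : Measure (ℝ × ℝ) := (gaussianReal 0 1).prod (gaussianReal 0 1)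

lemma hasGaussianLaw_id_stdGaussianPi :
    HasGaussianLaw (fun v : ι → ℝ => v) (stdGaussianPi ι) := by
  refine iIndepFun.hasGaussianLaw (X := fun i (v : ι → ℝ) => v i) (fun i => ?_)
    (iIndepFun_pi (X := fun _ x => x) fun _ => aemeasurable_id)
  have := (measurePreserving_eval (fun _ : ι => gaussianReal 0 1) i).map_eq
  exact ⟨by rw [show (fun v : ι → ℝ => v i) = Function.eval i from rfl, this]; infer_instance⟩

lemma hasGaussianLaw_dotCLM (a : ι → ℝ) : HasGaussianLaw (dotCLM a) (stdGaussianPi ι) :=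
  hasGaussianLaw_id_stdGaussianPi.map (dotCLM a)

lemma variance_dotCLM (a : ι → ℝ) : Var[dotCLM a; stdGaussianPi ι] = ∑ i, a i ^ 2 := by
  have hsum : (dotCLM a : (ι → ℝ) → ℝ) = ∑ i, fun v => a i * v i := by
    ext v
    simp [dotCLM_apply, mul_comm]
  rw [hsum, variance_sum_pi (X := fun i x => a i * x) fun i => by
    simpa using (IsGaussian.memLp_two_id (μ := gaussianReal 0 1)).const_mul (a i)]
  refine Finset.sum_congr rfl fun i _ => ?_
  rw [variance_const_mul, variance_fun_id_gaussianReal]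
  simp

lemma map_dotCLM_stdGaussianPi (a : ι → ℝ) :
    (stdGaussianPi ι).map (dotCLM a) = (gaussianReal 0 1).map (√(∑ i, a i ^ 2) * ·) := by
  have hmean : ∫ v, dotCLM a v ∂stdGaussianPi ι = 0 := by
    have hint (i : ι) : Integrable (fun v : ι → ℝ => v i * a i) (stdGaussianPi ι) :=
      (((measurePreserving_eval (fun _ : ι => gaussianReal 0 1) i).integrable_comp_of_integrable
        (g := id) (by simpa using IsGaussian.integrable_id))).mul_const (a i)
    simp_rw [dotCLM_apply]
    rw [integral_finsetSum _ fun i _ => hint i]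
    refine Finset.sum_eq_zero fun i _ => ?_
    have hzero : ∫ v : ι → ℝ, v i ∂stdGaussianPi ι = 0 := by
      simpa using integral_comp_eval (μ := fun _ : ι => gaussianReal 0 1) (i := i) (f := id)
        aestronglyMeasurable_id
    rw [integral_mul_const, hzero, zero_mul]
  rw [(hasGaussianLaw_dotCLM a).map_eq_gaussianReal, hmean, variance_dotCLM,
    gaussianReal_map_const_mul]
  congr
  · simp
  · ext
    simp [Real.sq_sqrt, Finset.sum_nonneg, sq_nonneg]

lemma indepFun_dotCLM {a b : ι → ℝ} (hab : ∑ i, a i * b i = 0) :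
    IndepFun (dotCLM a) (dotCLM b) (stdGaussianPi ι) := by
  refine (hasGaussianLaw_id_stdGaussianPi.map ((dotCLM a).prod (dotCLM b))
    ).indepFun_of_covariance_eq_zero ?_
  change cov[dotCLM a, dotCLM b; stdGaussianPi ι] = 0
  have h := variance_add (hasGaussianLaw_dotCLM a).memLp_two (hasGaussianLaw_dotCLM b).memLp_two
  rw [← FunLike.coe_add, ← dotCLM_add, variance_dotCLM, variance_dotCLM,
    variance_dotCLM] at h
  simp only [Pi.add_apply, add_sq, Finset.sum_add_distrib, mul_assoc, ← Finset.mul_sum, hab] at h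
  linarith

lemma map_dotCLM_prod_stdGaussianPi {a b : ι → ℝ} (hab : ∑ i, a i * b i = 0) :
    (stdGaussianPi ι).map ((dotCLM a).prod (dotCLM b)) =
      gauss2.map (Prod.map (√(∑ i, a i ^ 2) * ·) (√(∑ i, b i ^ 2) * ·)) := by
  have h := (indepFun_iff_map_prod_eq_prod_map_map (dotCLM a).measurable.aemeasurable
    (dotCLM b).measurable.aemeasurable).1 (indepFun_dotCLM hab)
  rw [← Measure.map_prod_map _ _ (by fun_prop) (by fun_prop), ← map_dotCLM_stdGaussianPi,
    ← map_dotCLM_stdGaussianPi, ← h]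
  rfl

end GaussianVectors

section HitCount

variable {ι α : Type*} [Fintype ι] (E : Set α) [DecidablePred (· ∈ E)]

/-- The number of coordinates of `w` that lie in `E`. -/
def hitCount (w : ι → α) : ℕ := (Finset.univ.filter fun i => w i ∈ E).card

lemma hitCount_le_card (w : ι → α) : hitCount E w ≤ Fintype.card ι := Finset.card_le_univ _

lemma hitCount_add_hitCount_compl (w : ι → α) :
    hitCount E w + hitCount Eᶜ w = Fintype.card ι :=
  Finset.card_filter_add_card_filter_not _

variable {E}

lemma hitCount_mono {F : Set α} [DecidablePred (· ∈ F)] (hEF : E ⊆ F) (w : ι → α) :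
    hitCount E w ≤ hitCount F w :=
  Finset.card_le_card <| Finset.monotone_filter_right _ fun _ _ hi => hEF hi

lemma hitCount_eq_sum_indicator (w : ι → α) :
    (hitCount E w : ℝ) = ∑ i, E.indicator (1 : α → ℝ) (w i) := by
  simp [hitCount, Set.indicator_apply]

@[fun_prop]
lemma measurable_hitCount [MeasurableSpace α] (hE : MeasurableSet E) :
    Measurable (hitCount (ι := ι) E) := by
  unfold hitCount
  simp only [Finset.card_filter]
  exact Finset.measurable_sum _ fun i _ =>
    Measurable.ite (measurable_pi_apply i hE) measurable_const measurable_const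

/-- `hitCount` with its range as codomain. -/
def hitCountFin {n : ℕ} (E : Set α) [DecidablePred (· ∈ E)] (w : Fin n → α) : Fin (n + 1) :=
  ⟨hitCount E w, Nat.lt_succ_of_le (by simpa using hitCount_le_card E w)⟩

@[fun_prop]
lemma measurable_hitCountFin {n : ℕ} [MeasurableSpace α] (hE : MeasurableSet E) :
    Measurable (hitCountFin (n := n) E) := by
  refine measurable_to_countable' fun d => ?_
  convert! measurable_hitCount (ι := Fin n) hE (measurableSet_singleton (d : ℕ)) using 1
  ext w
  simp [hitCountFin, Fin.ext_iff]

end HitCount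

section Crossing

lemma sgn_of_nonneg {x : ℝ} (h : 0 ≤ x) : sgn x = 1 := if_pos h

lemma sgn_of_neg {x : ℝ} (h : x < 0) : sgn x = -1 := if_neg h.not_ge

lemma sgn_neg {x : ℝ} (h : x ≠ 0) : sgn (-x) = -sgn x := by
  rcases h.lt_or_gt with h | h
  · rw [sgn_of_neg h, sgn_of_nonneg (neg_nonneg.2 h.le), neg_neg]
  · rw [sgn_of_nonneg h.le, sgn_of_neg (neg_neg_iff_pos.2 h)]

lemma sgn_mul_of_pos {c : ℝ} (hc : 0 < c) (x : ℝ) : sgn (c * x) = sgn x := by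
  simp only [sgn, mul_nonneg_iff_of_pos_left hc]

@[fun_prop]
lemma measurable_sgn : Measurable sgn :=
  Measurable.ite measurableSet_Ici measurable_const measurable_const

instance : MeasurableSingletonClass ℤˣ :=
  ⟨fun u => ⟨{(u : ℤ)}, measurableSet_singleton _, by ext v; simp [Units.ext_iff]⟩⟩

/-- The pairs of reals with different signs. -/
def discord : Set (ℝ × ℝ) := {p | sgn p.1 ≠ sgn p.2}

instance : DecidablePred (· ∈ discord) := fun p => inferInstanceAs (Decidable (sgn p.1 ≠ sgn p.2))

lemma measurableSet_discord : MeasurableSet discord :=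
  (measurableSet_eq_fun (by fun_prop) (by fun_prop)).compl

lemma smul_mem_discord {c : ℝ} (hc : 0 < c) (p : ℝ × ℝ) : c • p ∈ discord ↔ p ∈ discord := by
  simp [discord, sgn_mul_of_pos hc]

lemma add_sub_mem_discord_of_abs_lt {u v : ℝ} (h : |u| < |v|) : (u + v, u - v) ∈ discord := by
  rw [discord, Set.mem_ofPred_eq]
  obtain ⟨h1, h2⟩ := abs_lt.1 h
  rcases abs_cases v with ⟨hv, -⟩ | ⟨hv, -⟩ <;> rw [hv] at h1 h2
  · rw [sgn_of_nonneg (by linarith), sgn_of_neg (by linarith)]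
    decide
  · rw [sgn_of_neg (by linarith), sgn_of_nonneg (by linarith)]
    decide

lemma abs_le_of_add_sub_mem_discord {u v : ℝ} (h : (u + v, u - v) ∈ discord) : |u| ≤ |v| := by
  contrapose! h
  rw [discord, Set.mem_ofPred_eq, not_ne_iff]
  obtain ⟨h1, h2⟩ := abs_lt.1 h
  rcases abs_cases u with ⟨hu, -⟩ | ⟨hu, -⟩ <;> rw [hu] at h1 h2
  · rw [sgn_of_nonneg (by linarith), sgn_of_nonneg (by linarith)]
  · rw [sgn_of_neg (by linarith), sgn_of_neg (by linarith)]

/-- The linear map `(u, v) ↦ (√(1 - a) u + √a v, √(1 - a) u - √a v)`. It takes two independent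
standard Gaussians to two standard Gaussians with correlation `1 - 2 * a`, like the normalized
inner products of a Gaussian vector with two points of the cube that differ in a proportion `a` of
their coordinates. -/
def correlate (a : ℝ) : (ℝ × ℝ) →L[ℝ] ℝ × ℝ :=
  let u := √(1 - a) • ContinuousLinearMap.fst ℝ ℝ ℝ
  let v := √a • ContinuousLinearMap.snd ℝ ℝ ℝ
  (u + v).prod (u - v)

lemma correlate_apply (a : ℝ) (z : ℝ × ℝ) :
    correlate a z = (√(1 - a) * z.1 + √a * z.2, √(1 - a) * z.1 - √a * z.2) := rfl

@[fun_prop]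
lemma measurable_correlate (a : ℝ) : Measurable (correlate a) := (correlate a).measurable

/-- The pairs to which `correlate a` gives different signs. -/
def crossing (a : ℝ) : Set (ℝ × ℝ) := correlate a ⁻¹' discord

instance (a : ℝ) : DecidablePred (· ∈ crossing a) := fun z =>
  inferInstanceAs (Decidable (correlate a z ∈ discord))

lemma measurableSet_crossing (a : ℝ) : MeasurableSet (crossing a) :=
  measurable_correlate a measurableSet_discord

lemma crossing_mono {a b : ℝ} (ha : 0 ≤ a) (hab : a ≤ b) : crossing a ⊆ crossing b := by
  rcases hab.eq_or_lt with rfl | hlt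
  · rfl
  rintro ⟨u, v⟩ (h : correlate a (u, v) ∈ discord)
  rw [correlate_apply] at h
  have hv : 0 < |v| := by
    refine abs_pos.2 fun hv => ?_
    simp [hv, discord] at h
  have hle := abs_le_of_add_sub_mem_discord h
  refine add_sub_mem_discord_of_abs_lt ?_
  have hlt := Real.sqrt_lt_sqrt ha hlt
  change |√(1 - a) * u| ≤ |√a * v| at hle
  change |√(1 - b) * u| < |√b * v|
  simp only [abs_mul, abs_of_nonneg (Real.sqrt_nonneg _)] at hle ⊢
  calc √(1 - b) * |u| ≤ √(1 - a) * |u| := by gcongr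
    _ ≤ √a * |v| := hle
    _ < √b * |v| := by gcongr

end Crossing

section ProductLaw

variable {α β : Type*} [MeasurableSpace α] [MeasurableSpace β] {μ : Measure α} {ν : Measure β}
  {S : Set (α × β)} {Z : Set α} {q : ℝ}

lemma mul_le_prod_real [IsFiniteMeasure μ] [IsFiniteMeasure ν] (hS : MeasurableSet S)
    (hZ : MeasurableSet Z) (h : ∀ x ∈ Z, q ≤ ν.real (Prod.mk x ⁻¹' S)) :
    q * μ.real Z ≤ (μ.prod ν).real S := by
  refine (ENNReal.ofReal_le_iff_le_toReal (measure_ne_top _ _)).1 ?_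
  rw [Measure.prod_apply hS, ENNReal.ofReal_mul' measureReal_nonneg, ofReal_measureReal,
    ← setLIntegral_const]
  refine (setLIntegral_mono' hZ fun x hx => ?_).trans (setLIntegral_le_lintegral Z _)
  exact (ENNReal.ofReal_le_iff_le_toReal (measure_ne_top _ _)).2 (h x hx)

lemma prod_real_le [IsProbabilityMeasure μ] [IsProbabilityMeasure ν] (hS : MeasurableSet S)
    (hZ : MeasurableSet Z) (hq : 0 ≤ q) (h : ∀ x ∈ Z, ν.real (Prod.mk x ⁻¹' S) ≤ q) :
    (μ.prod ν).real S ≤ μ.real Zᶜ + q := by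
  have hcompl := mul_le_prod_real (μ := μ) (ν := ν) hS.compl hZ (q := 1 - q) fun x hx => by
    rw [Set.preimage_compl, probReal_compl_eq_one_sub (measurable_prodMk_left hS)]
    linarith [h x hx]
  rw [probReal_compl_eq_one_sub hS] at hcompl
  rw [probReal_compl_eq_one_sub hZ]
  linarith [mul_le_of_le_one_right hq (measureReal_le_one (μ := μ) (s := Z))]

end ProductLaw

section EquicorrelatedLaw

variable {ι E F : Type*} [Fintype ι]
  [AddCommGroup E] [Module ℝ E] [MeasurableSpace E] [MeasurableAdd₂ E] [MeasurableConstSMul ℝ E]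
  [AddCommGroup F] [Module ℝ F] [MeasurableSpace F] [MeasurableAdd₂ F] [MeasurableConstSMul ℝ F]

/-- The joint law of the variables `√ρ ν + √(1 - ρ) ψ i`, where `ν` and all `ψ i` are independent
with law `μ`. -/
def equicorrLaw (ι : Type*) [Fintype ι] (ρ : ℝ) (μ : Measure E) : Measure (ι → E) :=
  (μ.prod (Measure.pi fun _ : ι => μ)).map fun ξ i => √ρ • ξ.1 + √(1 - ρ) • ξ.2 i

/-- The law of `√ρ ν + √(1 - ρ) ψ` for a given value of the common noise `ν`, where `ψ` has law
`μ`. -/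
def shiftLaw (ρ : ℝ) (μ : Measure E) (ν : E) : Measure E :=
  μ.map fun ψ => √ρ • ν + √(1 - ρ) • ψ

variable {ρ : ℝ} {μ : Measure E} [IsProbabilityMeasure μ]

instance : IsProbabilityMeasure (equicorrLaw ι ρ μ) :=
  Measure.isProbabilityMeasure_map (by fun_prop)

instance (ν : E) : IsProbabilityMeasure (shiftLaw ρ μ ν) :=
  Measure.isProbabilityMeasure_map (by fun_prop)

lemma map_equicorrLaw {ℓ : E →ₗ[ℝ] F} (hℓ : Measurable ℓ) :
    (equicorrLaw ι ρ μ).map (fun W i => ℓ (W i)) = equicorrLaw ι ρ (μ.map ℓ) := by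
  have : IsProbabilityMeasure (μ.map ℓ) := Measure.isProbabilityMeasure_map hℓ.aemeasurable
  rw [equicorrLaw, equicorrLaw, Measure.map_map (by fun_prop) (by fun_prop),
    ← Measure.pi_map_pi fun _ => hℓ.aemeasurable, Measure.map_prod_map _ _ hℓ (by fun_prop),
    Measure.map_map (by fun_prop) (by fun_prop)]
  congr 1
  ext ξ i
  simp

lemma map_equicorrLaw_congr {G : Type*} [AddCommGroup G] [Module ℝ G] [MeasurableSpace G]
    [MeasurableAdd₂ G] [MeasurableConstSMul ℝ G] {μ' : Measure F} [IsProbabilityMeasure μ']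
    {ℓ : E →ₗ[ℝ] G} {κ : F →ₗ[ℝ] G} (hℓ : Measurable ℓ) (hκ : Measurable κ)
    (h : μ.map ℓ = μ'.map κ) :
    (equicorrLaw ι ρ μ).map (fun W i => ℓ (W i)) =
      (equicorrLaw ι ρ μ').map fun W i => κ (W i) := by
  rw [map_equicorrLaw hℓ, map_equicorrLaw hκ, h]

lemma map_pi_eq_pi_shiftLaw (ν : E) :
    (Measure.pi fun _ : ι => μ).map (fun ψ i => √ρ • ν + √(1 - ρ) • ψ i) =
      Measure.pi fun _ : ι => shiftLaw ρ μ ν :=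
  Measure.pi_map_pi (f := fun _ ψ => √ρ • ν + √(1 - ρ) • ψ) fun _ => by fun_prop

lemma equicorrLaw_apply {S : Set (ι → E)} (hS : MeasurableSet S) :
    equicorrLaw ι ρ μ S = ∫⁻ ν, Measure.pi (fun _ : ι => shiftLaw ρ μ ν) S ∂μ := by
  rw [equicorrLaw, Measure.map_apply (by fun_prop) hS,
    Measure.prod_apply (measurableSet_preimage (by fun_prop) hS)]
  refine lintegral_congr fun ν => ?_
  rw [← map_pi_eq_pi_shiftLaw, Measure.map_apply (by fun_prop) hS]
  rfl

lemma mul_le_equicorrLaw_real {S : Set (ι → E)} (hS : MeasurableSet S) {Z : Set E}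
    (hZ : MeasurableSet Z) {q : ℝ}
    (h : ∀ ν ∈ Z, q ≤ (Measure.pi fun _ : ι => shiftLaw ρ μ ν).real S) :
    q * μ.real Z ≤ (equicorrLaw ι ρ μ).real S := by
  rw [equicorrLaw, map_measureReal_apply (by fun_prop) hS]
  refine mul_le_prod_real (measurableSet_preimage (by fun_prop) hS) hZ fun ν hν => ?_
  have hq := h ν hν
  rwa [← map_pi_eq_pi_shiftLaw, map_measureReal_apply (by fun_prop) hS] at hq

lemma equicorrLaw_real_le {S : Set (ι → E)} (hS : MeasurableSet S) {Z : Set E}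
    (hZ : MeasurableSet Z) {q : ℝ} (hq : 0 ≤ q)
    (h : ∀ ν ∈ Z, (Measure.pi fun _ : ι => shiftLaw ρ μ ν).real S ≤ q) :
    (equicorrLaw ι ρ μ).real S ≤ μ.real Zᶜ + q := by
  rw [equicorrLaw, map_measureReal_apply (by fun_prop) hS]
  refine prod_real_le (measurableSet_preimage (by fun_prop) hS) hZ hq fun ν hν => ?_
  have hq := h ν hν
  rwa [← map_pi_eq_pi_shiftLaw, map_measureReal_apply (by fun_prop) hS] at hq

lemma ae_equicorrLaw_apply_ne [MeasurableSingletonClass E] [NullSingletonClass μ] (hρ : ρ < 1)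
    (c : E) : ∀ᵐ W ∂equicorrLaw ι ρ μ, ∀ i, W i ≠ c := by
  have hs : √(1 - ρ) ≠ 0 := (Real.sqrt_pos.2 (sub_pos.2 hρ)).ne'
  have hshift (ν : E) : NullSingletonClass (shiftLaw ρ μ ν) := ⟨fun x => by
    rw [shiftLaw, Measure.map_apply (by fun_prop) (measurableSet_singleton x)]
    refine Set.Subsingleton.measure_zero (fun ψ hψ φ hφ => ?_) μ
    exact smul_right_injective E hs (add_left_cancel (hψ.trans hφ.symm))⟩
  refine ae_all_iff.2 fun i => ?_
  have hi : MeasurableSet {W : ι → E | W i = c} :=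
    (measurableSet_singleton c).preimage (measurable_pi_apply i)
  simp only [ae_iff, not_not, equicorrLaw_apply hi, Measure.pi_hyperplane, lintegral_zero]

end EquicorrelatedLaw

section CubeGeometry

variable {n : ℕ}

/-- The embedding of the cube into `ℝ^n`. -/
def toReal (x : Cube n) : Fin n → ℝ := fun j => ((x j : ℤ) : ℝ)

lemma toReal_neg (x : Cube n) : toReal (-x) = -toReal x := by
  ext j
  simp [toReal]

lemma toReal_sq (x : Cube n) (j : Fin n) : toReal x j ^ 2 = 1 := by
  rcases Int.units_eq_one_or (x j) with h | h <;> simp [toReal, h]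

lemma sum_toReal_sq (x : Cube n) : ∑ j, toReal x j ^ 2 = n := by simp [toReal_sq]

lemma sum_sq_half_sub (x y : Cube n) :
    ∑ j, ((toReal x j - toReal y j) / 2) ^ 2 = (hammingDist x y : ℝ) := by
  rw [hammingDist, Finset.card_filter, Nat.cast_sum]
  refine Finset.sum_congr rfl fun j _ => ?_
  rcases Int.units_eq_one_or (x j) with h | h <;> rcases Int.units_eq_one_or (y j) with h' | h' <;>
    norm_num [toReal, h, h']

lemma sum_sq_half_add (x y : Cube n) :
    ∑ j, ((toReal x j + toReal y j) / 2) ^ 2 = (n : ℝ) - (hammingDist x y : ℝ) := by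
  rw [← sum_sq_half_sub, eq_sub_iff_add_eq, ← Finset.sum_add_distrib, ← sum_toReal_sq x]
  refine Finset.sum_congr rfl fun j _ => ?_
  linear_combination toReal_sq y j / 2 - toReal_sq x j / 2

/-- The Hamming distance on the cube, as a state of the distance chain. -/
def cubeDist (x y : Cube n) : Fin (n + 1) :=
  ⟨hammingDist x y, Nat.lt_succ_of_le (by
    simpa using hammingDist_le_card_fintype (x := x) (y := y))⟩

lemma cubeDist_neg_right (x y : Cube n) : cubeDist x (-y) = (cubeDist x y).rev := by
  have hadd : (hammingDist x (-y) : ℝ) + hammingDist x y = n := by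
    rw [← eq_sub_iff_add_eq, ← sum_sq_half_sub, ← sum_sq_half_add]
    simp [toReal_neg]
  norm_cast at hadd
  ext
  simp only [cubeDist, Fin.val_rev]
  omega

lemma exists_cubeDist_eq (d : Fin (n + 1)) : ∃ x y : Cube n, cubeDist x y = d := by
  refine ⟨1, fun j => if (j : ℕ) < d then -1 else 1, Fin.ext ?_⟩
  have hfilter : (Finset.univ.filter fun j : Fin n => (1 : ℤˣ) ≠ if (j : ℕ) < d then -1 else 1) =
      Finset.univ.filter fun j : Fin n => (j : ℕ) < d := by
    ext j
    by_cases h : (j : ℕ) < d <;> simp [h]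
  simp only [cubeDist, hammingDist, Pi.one_apply]
  rw [hfilter, Fin.card_filter_val_lt, min_eq_right d.is_le]

end CubeGeometry

section Layer

variable {n : ℕ} {ρ : ℝ}

lemma layer_apply (W : Fin n → Fin n → ℝ) (x : Cube n) (i : Fin n) :
    layer W x i = sgn (dotCLM (toReal x) (W i)) := by
  rw [dotCLM_apply]
  rfl

@[fun_prop]
lemma measurable_layer (x : Cube n) : Measurable fun W : Fin n → Fin n → ℝ => layer W x := by
  unfold layer
  fun_prop

instance : IsProbabilityMeasure (layerLaw n ρ) :=
  inferInstanceAs (IsProbabilityMeasure (equicorrLaw _ _ _))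

lemma map_layerLaw_dotCLM (x : Cube n) :
    (layerLaw n ρ).map (fun W i => dotCLM (toReal x) (W i)) =
      (equicorrLaw (Fin n) ρ (gaussianReal 0 1)).map fun z i => √(n : ℝ) * z i := by
  refine map_equicorrLaw_congr (ℓ := (dotCLM (toReal x)).toLinearMap)
    (κ := LinearMap.mulLeft ℝ √(n : ℝ)) (measurable_dotCLM _) (measurable_const_mul _) ?_
  convert! map_dotCLM_stdGaussianPi (toReal x)
  rw [sum_toReal_sq]
  rfl

lemma ae_dotCLM_row_ne_zero (hρ : ρ < 1) (x : Cube n) :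
    ∀ᵐ W ∂layerLaw n ρ, ∀ i, dotCLM (toReal x) (W i) ≠ 0 := by
  have := nullSingletonClass_gaussianReal (μ := 0) one_ne_zero
  have hne : ∀ᵐ u ∂(layerLaw n ρ).map (fun W i => dotCLM (toReal x) (W i)), ∀ i, u i ≠ 0 := by
    rw [map_layerLaw_dotCLM]
    refine (ae_map_iff (Measurable.aemeasurable (by fun_prop)) ?_).2 ?_
    · exact (MeasurableSet.univ_pi fun _ => (measurableSet_singleton 0).compl).congr (by ext; simp)
    · filter_upwards [ae_equicorrLaw_apply_ne hρ 0] with z hz i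
      have := i.pos
      exact mul_ne_zero (by positivity) (hz i)
  exact ae_of_ae_map (Measurable.aemeasurable (by fun_prop)) hne

lemma layer_neg {W : Fin n → Fin n → ℝ} {x : Cube n} (h : ∀ i, dotCLM (toReal x) (W i) ≠ 0) :
    layer W (-x) = -layer W x := by
  ext1 i
  rw [layer_apply, toReal_neg, dotCLM_neg, Pi.neg_apply, layer_apply, neg_apply, sgn_neg (h i)]

end Layer

section DistanceChain

variable {n : ℕ} {ρ : ℝ}

lemma map_dotCLM_prod_eq_map_correlate (hn : 0 < n) (x y : Cube n) :
    (stdGaussianPi (Fin n)).map ((dotCLM (toReal x)).prod (dotCLM (toReal y))) =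
      gauss2.map (√(n : ℝ) • correlate (cubeDist x y / n)) := by
  set u := fun j => (toReal x j + toReal y j) / 2
  set v := fun j => (toReal x j - toReal y j) / 2
  have horth : ∑ j, u j * v j = 0 := Finset.sum_eq_zero fun j _ => by
    linear_combination toReal_sq x j / 4 - toReal_sq y j / 4
  have hxy : ⇑((dotCLM (toReal x)).prod (dotCLM (toReal y))) =
      (fun p : ℝ × ℝ => (p.1 + p.2, p.1 - p.2)) ∘ (dotCLM u).prod (dotCLM v) := by
    have hx : toReal x = u + v := by ext j; simp only [u, v, Pi.add_apply]; ring
    have hy : toReal y = u + -v := by ext j; simp only [u, v, Pi.add_apply, Pi.neg_apply]; ring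
    rw [hx, hy, dotCLM_add, dotCLM_add, dotCLM_neg, ← sub_eq_add_neg]
    rfl
  have hscale : ⇑(√(n : ℝ) • correlate (cubeDist x y / n)) =
      (fun p : ℝ × ℝ => (p.1 + p.2, p.1 - p.2)) ∘
        Prod.map (√(∑ j, u j ^ 2) * ·) (√(∑ j, v j ^ 2) * ·) := by
    have hn' : (0 : ℝ) < n := by exact_mod_cast hn
    rw [sum_sq_half_add, sum_sq_half_sub]
    have hadd : √((n : ℝ) - hammingDist x y) = √n * √(1 - hammingDist x y / n) := by
      rw [← Real.sqrt_mul hn'.le]; congr 1; field_simp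
    have hsub : √(hammingDist x y : ℝ) = √n * √(hammingDist x y / n) := by
      rw [← Real.sqrt_mul hn'.le]; congr 1; field_simp
    rw [hadd, hsub]
    ext z <;> simp [correlate_apply, cubeDist] <;> ring
  rw [hxy, hscale, ← Measure.map_map (by fun_prop) (by fun_prop),
    map_dotCLM_prod_stdGaussianPi horth, Measure.map_map (by fun_prop) (by fun_prop)]

lemma map_layerLaw_dotCLM_prod (hn : 0 < n) (x y : Cube n) :
    (layerLaw n ρ).map (fun W i => (dotCLM (toReal x)).prod (dotCLM (toReal y)) (W i)) =
      (equicorrLaw (Fin n) ρ gauss2).map fun z i =>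
        (√(n : ℝ) • correlate (cubeDist x y / n)) (z i) :=
  map_equicorrLaw_congr (ℓ := ((dotCLM (toReal x)).prod (dotCLM (toReal y))).toLinearMap)
    (κ := (√(n : ℝ) • correlate (cubeDist x y / n)).toLinearMap)
    (ContinuousLinearMap.measurable _) (ContinuousLinearMap.measurable _)
    (map_dotCLM_prod_eq_map_correlate hn x y)

/-- One step of the chain of Hamming distances between the images of two points under random
layers, driven by Gaussian pairs `z i`. -/
def distStep (z : Fin n → ℝ × ℝ) (d : Fin (n + 1)) : Fin (n + 1) :=
  hitCountFin (crossing (d / n)) z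

lemma monotone_distStep (z : Fin n → ℝ × ℝ) : Monotone (distStep z) := fun d e hde =>
  hitCount_mono (crossing_mono (by positivity) (by gcongr; exact_mod_cast hde)) z

lemma measurable_distStep (d : Fin (n + 1)) : Measurable fun z : Fin n → ℝ × ℝ => distStep z d :=
  measurable_hitCountFin (measurableSet_crossing _)

/-- The transition operator of the chain of Hamming distances. -/
def distOp (n : ℕ) (ρ : ℝ) : Module.End ℝ (Fin (n + 1) → ℝ) :=
  randomMapOp (equicorrLaw (Fin n) ρ gauss2) distStep measurable_distStep

lemma isMarkov_distOp : IsMarkov (distOp n ρ) := isMarkov_randomMapOp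

lemma isStochasticallyMonotone_distOp : IsStochasticallyMonotone (distOp n ρ) :=
  isStochasticallyMonotone_randomMapOp monotone_distStep

lemma integral_cubeDist_layer (hn : 0 < n) (g : Fin (n + 1) → ℝ) (x y : Cube n) :
    ∫ W, g (cubeDist (layer W x) (layer W y)) ∂layerLaw n ρ = distOp n ρ g (cubeDist x y) := by
  let ℓ := (dotCLM (toReal x)).prod (dotCLM (toReal y))
  let κ (p : ℝ × ℝ) := √(n : ℝ) • correlate (cubeDist x y / n) p
  have hG : Measurable fun p : Fin n → ℝ × ℝ => g (hitCountFin discord p) :=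
    (measurable_of_finite g).comp (measurable_hitCountFin measurableSet_discord)
  calc ∫ W, g (cubeDist (layer W x) (layer W y)) ∂layerLaw n ρ
      = ∫ W, g (hitCountFin discord fun i => ℓ (W i)) ∂layerLaw n ρ := by
        refine integral_congr_ae (ae_of_all _ fun W => congrArg g (Fin.ext ?_))
        simp only [cubeDist, hammingDist, layer_apply]
        rfl
    _ = ∫ z, g (hitCountFin discord fun i => κ (z i)) ∂equicorrLaw (Fin n) ρ gauss2 := by
        rw [← integral_map (φ := fun W : Fin n → Fin n → ℝ => fun i => ℓ (W i))
            (Measurable.aemeasurable (by fun_prop)) hG.aestronglyMeasurable,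
          map_layerLaw_dotCLM_prod hn,
          integral_map (Measurable.aemeasurable (by fun_prop)) hG.aestronglyMeasurable]
        rfl
    _ = distOp n ρ g (cubeDist x y) := by
        refine integral_congr_ae (ae_of_all _ fun z => congrArg g (Fin.ext ?_))
        have hn' : 0 < √(n : ℝ) := by positivity
        simp only [distStep, hitCountFin, hitCount, crossing, κ, smul_mem_discord hn',
          Set.mem_preimage]

lemma distOp_comp_rev (hn : 0 < n) (hρ : ρ < 1) (g : Fin (n + 1) → ℝ) :
    distOp n ρ (g ∘ Fin.rev) = distOp n ρ g ∘ Fin.rev := by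
  ext d
  obtain ⟨x, y, rfl⟩ := exists_cubeDist_eq d
  rw [Function.comp_apply, ← cubeDist_neg_right, ← integral_cubeDist_layer hn,
    ← integral_cubeDist_layer hn]
  refine integral_congr_ae ?_
  filter_upwards [ae_dotCLM_row_ne_zero hρ y] with W hW
  rw [layer_neg hW, cubeDist_neg_right, Function.comp_apply]

end DistanceChain

section GaussianEstimates

lemma gaussianReal_real_eq_setIntegral (s : Set ℝ) :
    (gaussianReal 0 1).real s = ∫ x in s, gaussianPDFReal 0 1 x := by
  rw [Measure.real, gaussianReal_apply_eq_integral _ one_ne_zero,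
    ENNReal.toReal_ofReal (integral_nonneg fun x => gaussianPDFReal_nonneg 0 1 x)]

lemma mul_exp_le_gaussianReal_ball (c : ℝ) {r : ℝ} (hr0 : 0 ≤ r) (hr1 : r ≤ 1) :
    r / 2 * Real.exp (-(|c| + 1) ^ 2 / 2) ≤ (gaussianReal 0 1).real (Metric.ball c r) := by
  have hpi : √(2 * Real.pi) ≤ 4 := by
    rw [Real.sqrt_le_left (by norm_num)]
    linarith [Real.pi_le_four]
  have hpdf : ∀ x ∈ Metric.ball c r,
      1 / 4 * Real.exp (-(|c| + 1) ^ 2 / 2) ≤ gaussianPDFReal 0 1 x := by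
    intro x hx
    have habs : |x| ≤ |c| + 1 := by
      have hxc := Metric.mem_ball.1 hx
      rw [Real.dist_eq] at hxc
      linarith [abs_sub_abs_le_abs_sub x c]
    have hsq : x ^ 2 ≤ (|c| + 1) ^ 2 := by
      rw [← sq_abs x]
      gcongr
    simp only [gaussianPDFReal, NNReal.coe_one, mul_one, sub_zero, one_div]
    gcongr
  rw [gaussianReal_real_eq_setIntegral]
  calc r / 2 * Real.exp (-(|c| + 1) ^ 2 / 2)
      = ∫ _ in Metric.ball c r, 1 / 4 * Real.exp (-(|c| + 1) ^ 2 / 2) := by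
        rw [setIntegral_const, Real.volume_real_ball hr0, smul_eq_mul]
        ring
    _ ≤ ∫ x in Metric.ball c r, gaussianPDFReal 0 1 x :=
        setIntegral_mono_on (integrableOn_const measure_ball_lt_top.ne)
          (integrable_gaussianPDFReal 0 1).integrableOn measurableSet_ball hpdf

lemma gaussianReal_ball_le {r : ℝ} (hr : 0 ≤ r) :
    (gaussianReal 0 1).real (Metric.ball 0 r) ≤ 2 * r := by
  have hpi : (√(2 * Real.pi))⁻¹ ≤ 1 :=
    inv_le_one_of_one_le₀ <| Real.one_le_sqrt.2 (by linarith [Real.pi_gt_three])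
  calc (gaussianReal 0 1).real (Metric.ball 0 r)
      = ∫ x in Metric.ball 0 r, gaussianPDFReal 0 1 x :=
        gaussianReal_real_eq_setIntegral _
    _ ≤ ∫ _ in Metric.ball (0 : ℝ) r, (1 : ℝ) := by
        refine setIntegral_mono_on (integrable_gaussianPDFReal 0 1).integrableOn
          (integrableOn_const measure_ball_lt_top.ne) measurableSet_ball fun x _ => ?_
        simp only [gaussianPDFReal, NNReal.coe_one, mul_one, sub_zero]
        exact mul_le_one₀ hpi (Real.exp_pos _).le
          (Real.exp_le_one_iff.2 (by linarith [sq_nonneg x]))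
    _ = 2 * r := by rw [setIntegral_const, Real.volume_real_ball hr, smul_eq_mul, mul_one]

lemma gaussianReal_compl_closedBall_le {r : ℝ} (hr : 0 ≤ r) :
    (gaussianReal 0 1).real (Metric.closedBall 0 r)ᶜ ≤ 2 * Real.exp (-r ^ 2 / 2) := by
  have hupper : (gaussianReal 0 1).real {x | r ≤ x} ≤ Real.exp (-r ^ 2 / 2) := by
    refine (measure_ge_le_exp_mul_mgf r hr (integrable_exp_mul_gaussianReal r)).trans_eq ?_
    rw [mgf_fun_id_gaussianReal, ← Real.exp_add, NNReal.coe_one]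
    ring_nf
  have hlower : (gaussianReal 0 1).real {x | x ≤ -r} ≤ Real.exp (-r ^ 2 / 2) := by
    refine (measure_le_le_exp_mul_mgf (-r) (neg_nonpos.2 hr)
      (integrable_exp_mul_gaussianReal (-r))).trans_eq ?_
    rw [mgf_fun_id_gaussianReal, ← Real.exp_add, NNReal.coe_one]
    ring_nf
  calc (gaussianReal 0 1).real (Metric.closedBall 0 r)ᶜ
      ≤ (gaussianReal 0 1).real ({x | r ≤ x} ∪ {x | x ≤ -r}) := by
        refine measureReal_mono fun x hx => ?_
        rw [Set.mem_compl_iff, mem_closedBall_zero_iff, not_le, Real.norm_eq_abs, lt_abs] at hx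
        exact hx.imp le_of_lt fun h => by rw [Set.mem_ofPred_eq]; linarith
    _ ≤ 2 * Real.exp (-r ^ 2 / 2) := (measureReal_union_le _ _).trans (by linarith)

end GaussianEstimates

section HitCountLaw

variable {ι α : Type*} [Fintype ι] [MeasurableSpace α] {ν : Measure α} [IsProbabilityMeasure ν]
  {E : Set α} [DecidablePred (· ∈ E)]

lemma mgf_hitCount_neg_one_le (hE : MeasurableSet E) {q : ℝ} (hq : q ≤ ν.real E) :
    mgf (fun w : ι → α => (hitCount E w : ℝ)) (Measure.pi fun _ => ν) (-1) ≤
      Real.exp (-(Fintype.card ι * q / 2)) := by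
  set c := 1 - Real.exp (-1)
  have hexp (w : ι → α) : Real.exp (-1 * (hitCount E w : ℝ)) =
      ∏ i, (1 - c * E.indicator 1 (w i)) := by
    rw [hitCount_eq_sum_indicator, Finset.mul_sum, Real.exp_sum]
    refine Finset.prod_congr rfl fun i _ => ?_
    by_cases h : w i ∈ E <;> simp [h, c]
  have hfactor : ∫ x, (1 - c * E.indicator (1 : α → ℝ) x) ∂ν = 1 - c * ν.real E := by
    have hind : Integrable (E.indicator (1 : α → ℝ)) ν := (integrable_const 1).indicator hE
    rw [integral_sub (integrable_const _) (hind.const_mul c), integral_const_mul,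
      integral_indicator_one hE]
    simp
  have hc : 1 / 2 ≤ c := by linarith [Real.exp_neg_one_lt_d9]
  have hc1 : c ≤ 1 := by linarith [Real.exp_pos (-1)]
  have hE0 : 0 ≤ ν.real E := measureReal_nonneg
  have hE1 : ν.real E ≤ 1 := measureReal_le_one
  rw [mgf]
  simp only [hexp]
  rw [integral_fintype_prod_eq_prod (f := fun (_ : ι) (x : α) => 1 - c * E.indicator 1 x),
    Finset.prod_const, hfactor, Finset.card_univ]
  calc (1 - c * ν.real E) ^ Fintype.card ι ≤ Real.exp (-(q / 2)) ^ Fintype.card ι := by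
        gcongr
        · nlinarith
        · nlinarith [Real.add_one_le_exp (-(q / 2))]
    _ = Real.exp (-(Fintype.card ι * q / 2)) := by rw [← Real.exp_nat_mul]; ring_nf

lemma pi_real_hitCount_le_le_exp (hE : MeasurableSet E) {q : ℝ} (hq : q ≤ ν.real E) :
    (Measure.pi fun _ : ι => ν).real {w | (hitCount E w : ℝ) ≤ Fintype.card ι * q / 4} ≤
      Real.exp (-(Fintype.card ι * q / 4)) := by
  have hint : Integrable (fun w : ι → α => Real.exp (-1 * (hitCount E w : ℝ)))
      (Measure.pi fun _ => ν) := by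
    refine Integrable.of_bound (by fun_prop (disch := assumption)) 1 (ae_of_all _ fun w => ?_)
    rw [Real.norm_eq_abs, Real.abs_exp, Real.exp_le_one_iff]
    simp
  calc (Measure.pi fun _ : ι => ν).real {w | (hitCount E w : ℝ) ≤ Fintype.card ι * q / 4}
      ≤ Real.exp (- -1 * (Fintype.card ι * q / 4)) * Real.exp (-(Fintype.card ι * q / 2)) :=
        (measure_le_le_exp_mul_mgf _ (by norm_num) hint).trans
          (mul_le_mul_of_nonneg_left (mgf_hitCount_neg_one_le hE hq) (Real.exp_pos _).le)
    _ = Real.exp (-(Fintype.card ι * q / 4)) := by rw [← Real.exp_add]; ring_nf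

lemma integrable_hitCount (hE : MeasurableSet E) :
    Integrable (fun w : ι → α => (hitCount E w : ℝ)) (Measure.pi fun _ => ν) := by
  refine Integrable.of_bound (by fun_prop (disch := assumption)) (Fintype.card ι)
    (ae_of_all _ fun w => ?_)
  rw [RCLike.norm_natCast]
  exact_mod_cast hitCount_le_card E w

lemma integral_hitCount (hE : MeasurableSet E) :
    ∫ w : ι → α, (hitCount E w : ℝ) ∂(Measure.pi fun _ => ν) = Fintype.card ι * ν.real E := by
  have hcoord (i : ι) := measurePreserving_eval (fun _ : ι => ν) i
  have hind (i : ι) :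
      Integrable (fun w : ι → α => E.indicator (1 : α → ℝ) (w i)) (Measure.pi fun _ => ν) :=
    (hcoord i).integrable_comp_of_integrable ((integrable_const 1).indicator hE)
  simp only [hitCount_eq_sum_indicator]
  rw [integral_finsetSum _ fun i _ => hind i]
  have hterm (i : ι) :
      ∫ w : ι → α, E.indicator 1 (w i) ∂(Measure.pi fun _ => ν) = ν.real E := by
    have hmap := integral_map (hcoord i).aemeasurable
      ((measurable_one (α := ℝ)).indicator hE).aestronglyMeasurable
    rw [(hcoord i).map_eq, integral_indicator_one hE] at hmap
    exact hmap.symm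
  simp [hterm]

lemma pi_real_card_le_two_mul_hitCount [Nonempty ι] (hE : MeasurableSet E)
    (h : 7 / 8 ≤ ν.real E) :
    3 / 4 ≤ (Measure.pi fun _ : ι => ν).real {w | Fintype.card ι ≤ 2 * hitCount E w} := by
  have hcard : (0 : ℝ) < Fintype.card ι := by exact_mod_cast Fintype.card_pos
  have hmarkov := mul_meas_ge_le_integral_of_nonneg (ae_of_all _ fun w => Nat.cast_nonneg _)
    (integrable_hitCount (ι := ι) (ν := ν) hE.compl) (Fintype.card ι / 2 : ℝ)
  rw [integral_hitCount hE.compl, probReal_compl_eq_one_sub hE] at hmarkov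
  have hsmall : (Measure.pi fun _ : ι => ν).real
      {w | (Fintype.card ι / 2 : ℝ) ≤ hitCount Eᶜ w} ≤ 1 / 4 := by
    by_contra! hc
    nlinarith
  have hmeas : MeasurableSet {w : ι → α | Fintype.card ι ≤ 2 * hitCount E w} :=
    measurable_hitCount hE (MeasurableSet.of_discrete (s := {e | Fintype.card ι ≤ 2 * e}))
  have hcompl : (Measure.pi fun _ : ι => ν).real
      {w : ι → α | Fintype.card ι ≤ 2 * hitCount E w}ᶜ ≤ 1 / 4 := by
    refine (measureReal_mono fun w hw => ?_).trans hsmall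
    simp only [Set.mem_compl_iff, Set.mem_ofPred_eq, not_le] at hw ⊢
    have hadd := hitCount_add_hitCount_compl E w
    rw [div_le_iff₀ two_pos]
    exact_mod_cast (by omega : Fintype.card ι ≤ hitCount Eᶜ w * 2)
  rw [probReal_compl_eq_one_sub hmeas] at hcompl
  linarith

end HitCountLaw

section CrossingProbability

variable {n : ℕ} {ρ : ℝ}

/-- The ratio of the standard deviations of the common and of the individual noise. -/
def noiseRatio (ρ : ℝ) : ℝ := √ρ / √(1 - ρ)

lemma noiseRatio_nonneg : 0 ≤ noiseRatio ρ := by unfold noiseRatio; positivity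

lemma mem_crossing_of_abs_lt {a : ℝ} (ha : 0 ≤ a) {u v : ℝ} (h : |u| < √a * |v|) :
    (u, v) ∈ crossing a := by
  have hsqrt : √(1 - a) ≤ 1 := Real.sqrt_le_one.2 (by linarith)
  refine add_sub_mem_discord_of_abs_lt ?_
  change |√(1 - a) * u| < |√a * v|
  rw [abs_mul, abs_mul, abs_of_nonneg (Real.sqrt_nonneg _), abs_of_nonneg (Real.sqrt_nonneg _)]
  exact (mul_le_of_le_one_left (abs_nonneg u) hsqrt).trans_lt h

lemma shiftLaw_real {E : Type*} [AddCommGroup E] [Module ℝ E] [MeasurableSpace E]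
    [MeasurableAdd₂ E] [MeasurableConstSMul ℝ E] {μ : Measure E} (ν : E) {s : Set E}
    (hs : MeasurableSet s) :
    (shiftLaw ρ μ ν).real s = μ.real {ψ | √ρ • ν + √(1 - ρ) • ψ ∈ s} :=
  map_measureReal_apply (by fun_prop) hs

lemma shiftLaw_gauss2 (ν : ℝ × ℝ) :
    shiftLaw ρ gauss2 ν =
      (shiftLaw ρ (gaussianReal 0 1) ν.1).prod (shiftLaw ρ (gaussianReal 0 1) ν.2) := by
  rw [shiftLaw, shiftLaw, shiftLaw, Measure.map_prod_map _ _ (by fun_prop) (by fun_prop)]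
  rfl

lemma mul_exp_le_shiftLaw_ball (hρ : ρ < 1) {r : ℝ} (hr0 : 0 ≤ r) (hr1 : r ≤ 1) (x : ℝ) :
    r / 2 * Real.exp (-(noiseRatio ρ * |x| + 1) ^ 2 / 2) ≤
      (shiftLaw ρ (gaussianReal 0 1) x).real (Metric.ball 0 (√(1 - ρ) * r)) := by
  have hs : 0 < √(1 - ρ) := Real.sqrt_pos.2 (sub_pos.2 hρ)
  have habs : |-(noiseRatio ρ * x)| = noiseRatio ρ * |x| := by
    rw [abs_neg, abs_mul, abs_of_nonneg noiseRatio_nonneg]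
  rw [shiftLaw_real _ measurableSet_ball, ← habs]
  refine (mul_exp_le_gaussianReal_ball _ hr0 hr1).trans (measureReal_mono fun ψ hψ => ?_)
  rw [mem_ball_iff_norm, sub_neg_eq_add] at hψ
  have hfactor : √ρ • x + √(1 - ρ) • ψ = √(1 - ρ) * (ψ + noiseRatio ρ * x) := by
    simp only [noiseRatio, smul_eq_mul]
    field_simp
    ring
  rw [Set.mem_ofPred_eq, mem_ball_zero_iff, hfactor, norm_mul, Real.norm_of_nonneg hs.le]
  gcongr

lemma exp_le_shiftLaw_compl_ball (y : ℝ) :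
    1 / 2 * Real.exp (-9 / 2) ≤
      (shiftLaw ρ (gaussianReal 0 1) y).real (Metric.ball 0 √(1 - ρ))ᶜ := by
  have hρ0 := Real.sqrt_nonneg ρ
  have hs0 := Real.sqrt_nonneg (1 - ρ)
  rw [shiftLaw_real _ measurableSet_ball.compl]
  -- The noise pushes `y` further away from `0`.
  obtain ⟨c, hc, hsub⟩ : ∃ c : ℝ, |c| = 2 ∧
      Metric.ball c 1 ⊆ {ψ | √ρ • y + √(1 - ρ) • ψ ∈ (Metric.ball (0 : ℝ) √(1 - ρ))ᶜ} := by
    simp only [Real.ball_eq_Ioo, Set.subset_def, Set.mem_Ioo, Set.mem_ofPred_eq, Set.mem_compl_iff,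
      smul_eq_mul]
    rcases le_total 0 y with hy | hy
    · refine ⟨2, by norm_num, fun ψ hψ hmem => ?_⟩
      nlinarith [mul_nonneg hρ0 hy, hmem.2, hψ.1]
    · refine ⟨-2, by norm_num, fun ψ hψ hmem => ?_⟩
      nlinarith [mul_nonneg hρ0 (neg_nonneg.2 hy), hmem.1, hψ.2]
  have hball := mul_exp_le_gaussianReal_ball c zero_le_one le_rfl
  rw [hc, show -((2 : ℝ) + 1) ^ 2 / 2 = -9 / 2 by norm_num] at hball
  exact hball.trans (measureReal_mono hsub)

lemma mul_sqrt_le_shiftLaw_crossing (hρ : ρ < 1) {a : ℝ} (ha : 0 ≤ a) (ha1 : a ≤ 1)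
    (ν : ℝ × ℝ) :
    Real.exp (-9 / 2) / 4 * Real.exp (-(noiseRatio ρ * |ν.1| + 1) ^ 2 / 2) * √a ≤
      (shiftLaw ρ gauss2 ν).real (crossing a) := by
  have hsub : Metric.ball 0 (√(1 - ρ) * √a) ×ˢ (Metric.ball 0 √(1 - ρ))ᶜ ⊆ crossing a := by
    rintro ⟨u, v⟩ ⟨hu, hv⟩
    simp only [Set.mem_compl_iff, mem_ball_zero_iff, not_lt, Real.norm_eq_abs] at hu hv
    refine mem_crossing_of_abs_lt ha (hu.trans_le ?_)
    rw [mul_comm]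
    gcongr
  calc Real.exp (-9 / 2) / 4 * Real.exp (-(noiseRatio ρ * |ν.1| + 1) ^ 2 / 2) * √a
      = (√a / 2 * Real.exp (-(noiseRatio ρ * |ν.1| + 1) ^ 2 / 2)) *
          (1 / 2 * Real.exp (-9 / 2)) := by ring
    _ ≤ _ := mul_le_mul
        (mul_exp_le_shiftLaw_ball hρ (Real.sqrt_nonneg a) (Real.sqrt_le_one.2 ha1) ν.1)
        (exp_le_shiftLaw_compl_ball ν.2) (by positivity) measureReal_nonneg
    _ = (shiftLaw ρ gauss2 ν).real
          (Metric.ball 0 (√(1 - ρ) * √a) ×ˢ (Metric.ball 0 √(1 - ρ))ᶜ) := by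
        rw [shiftLaw_gauss2, measureReal_prod_prod]
    _ ≤ (shiftLaw ρ gauss2 ν).real (crossing a) := measureReal_mono hsub

/-- The factor in the growth `d ↦ √(d * n)` of the distance chain, as long as the first component
of the common noise is at most `R` in terms of the individual noise. -/
def growthRate (R : ℝ) : ℝ := Real.exp (-9 / 2) / 16 * Real.exp (-(R + 1) ^ 2 / 2)

lemma growthRate_pos (R : ℝ) : 0 < growthRate R := by unfold growthRate; positivity

lemma growthRate_le_one (R : ℝ) : growthRate R ≤ 1 := by
  have h1 : Real.exp (-9 / 2) ≤ 1 := Real.exp_le_one_iff.2 (by norm_num)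
  have h2 : Real.exp (-(R + 1) ^ 2 / 2) ≤ 1 :=
    Real.exp_le_one_iff.2 (by linarith [sq_nonneg (R + 1)])
  have h3 := Real.exp_pos (-(R + 1) ^ 2 / 2)
  unfold growthRate
  nlinarith

lemma pi_shiftLaw_distStep_le_le_exp (hρ : ρ < 1) (d : Fin (n + 1)) {R : ℝ} {ν : ℝ × ℝ}
    (hν : noiseRatio ρ * |ν.1| ≤ R) :
    (Measure.pi fun _ : Fin n => shiftLaw ρ gauss2 ν).real
        {z | (distStep z d : ℝ) ≤ growthRate R * √((d : ℝ) * n)} ≤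
      Real.exp (-(growthRate R * √((d : ℝ) * n))) := by
  rcases Nat.eq_zero_or_pos n with rfl | hn
  · simp
  have hd1 : (d : ℝ) / n ≤ 1 := div_le_one_of_le₀ (by exact_mod_cast d.is_le) n.cast_nonneg
  have hcross : Real.exp (-9 / 2) / 4 * Real.exp (-(R + 1) ^ 2 / 2) * √((d : ℝ) / n) ≤
      (shiftLaw ρ gauss2 ν).real (crossing ((d : ℝ) / n)) := by
    refine le_trans ?_ (mul_sqrt_le_shiftLaw_crossing hρ (by positivity) hd1 ν)
    have hnonneg : 0 ≤ noiseRatio ρ * |ν.1| := mul_nonneg noiseRatio_nonneg (abs_nonneg _)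
    gcongr
  have hscale : (n : ℝ) * √((d : ℝ) / n) = √((d : ℝ) * n) := by
    rw [Real.sqrt_div' _ n.cast_nonneg, Real.sqrt_mul' _ n.cast_nonneg, mul_div_left_comm,
      Real.div_sqrt]
  have hlevel : Fintype.card (Fin n) *
      (Real.exp (-9 / 2) / 4 * Real.exp (-(R + 1) ^ 2 / 2) * √((d : ℝ) / n)) / 4 =
      growthRate R * √((d : ℝ) * n) := by
    rw [Fintype.card_fin, growthRate, ← hscale]
    ring
  have hcount := pi_real_hitCount_le_le_exp (ι := Fin n) (measurableSet_crossing _) hcross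
  rw [hlevel] at hcount
  exact hcount

end CrossingProbability

section DistanceStep

variable {n : ℕ} {ρ : ℝ}

/-- The distances smaller than `n / 2`. -/
def lowerHalf (n : ℕ) : Set (Fin (n + 1)) := {d | d < d.rev}

lemma mem_lowerHalf {d : Fin (n + 1)} : d ∈ lowerHalf n ↔ 2 * (d : ℕ) < n := by
  simp only [lowerHalf, Set.mem_ofPred_eq, Fin.lt_def, Fin.val_rev]
  omega

lemma isLowerSet_lowerHalf : IsLowerSet (lowerHalf n) := fun d e he hd => by
  rw [mem_lowerHalf] at hd ⊢
  have := Fin.le_def.1 he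
  omega

lemma distOp_indicator_one (s : Set (Fin (n + 1))) (d : Fin (n + 1)) :
    distOp n ρ (s.indicator 1) d =
      (equicorrLaw (Fin n) ρ gauss2).real {z | distStep z d ∈ s} :=
  randomMapOp_indicator_one s d

lemma measurableSet_distStep_mem (s : Set (Fin (n + 1))) (d : Fin (n + 1)) :
    MeasurableSet {z : Fin n → ℝ × ℝ | distStep z d ∈ s} :=
  measurable_distStep d .of_discrete

lemma gauss2_real_fst (s : Set ℝ) : gauss2.real (Prod.fst ⁻¹' s) = (gaussianReal 0 1).real s := by
  rw [← Set.prod_univ, measureReal_prod_prod, probReal_univ, mul_one]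

lemma mul_le_distOp_indicator_sqrt (hρ : ρ < 1) {d : Fin (n + 1)} (hd : 1 ≤ (d : ℕ))
    (hn : 1 ≤ growthRate 1 * √(n : ℝ)) {r : ℝ} (hr0 : 0 ≤ r) (hr1 : r ≤ 1)
    (hr : noiseRatio ρ * r ≤ 1) :
    r / 4 * Real.exp (-1 / 2) ≤
      distOp n ρ ({e : Fin (n + 1) | growthRate 1 * √((d : ℝ) * n) ≤ (e : ℝ)}.indicator 1) d := by
  have hgrow : 1 ≤ growthRate 1 * √((d : ℝ) * n) := by
    refine hn.trans (mul_le_mul_of_nonneg_left (Real.sqrt_le_sqrt ?_) (growthRate_pos 1).le)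
    exact le_mul_of_one_le_left n.cast_nonneg (by exact_mod_cast hd)
  let S : Set (Fin (n + 1)) := {e | growthRate 1 * √((d : ℝ) * n) ≤ (e : ℝ)}
  have hmeas := measurableSet_distStep_mem S d
  have hcond : ∀ ν ∈ (Prod.fst ⁻¹' Metric.ball (0 : ℝ) r : Set (ℝ × ℝ)), 1 / 2 ≤
      (Measure.pi fun _ : Fin n => shiftLaw ρ gauss2 ν).real
        {z | distStep z d ∈ S} := by
    intro ν hν
    rw [Set.mem_preimage, mem_ball_zero_iff, Real.norm_eq_abs] at hν
    have htail := pi_shiftLaw_distStep_le_le_exp hρ d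
      ((mul_le_mul_of_nonneg_left hν.le noiseRatio_nonneg).trans hr)
    have hexp : Real.exp (-(growthRate 1 * √((d : ℝ) * n))) ≤ 1 / 2 := by
      linarith [Real.exp_le_exp.2 (neg_le_neg hgrow), Real.exp_neg_one_lt_d9]
    have hcompl := probReal_compl_eq_one_sub
      (μ := Measure.pi fun _ : Fin n => shiftLaw ρ gauss2 ν) hmeas
    have hmono : (Measure.pi fun _ : Fin n => shiftLaw ρ gauss2 ν).real {z | distStep z d ∈ S}ᶜ ≤
        (Measure.pi fun _ : Fin n => shiftLaw ρ gauss2 ν).real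
          {z | (distStep z d : ℝ) ≤ growthRate 1 * √((d : ℝ) * n)} :=
      measureReal_mono fun z (hz : ¬ growthRate 1 * √((d : ℝ) * n) ≤ distStep z d) =>
        (not_le.1 hz).le
    linarith
  have hball : r / 2 * Real.exp (-1 / 2) ≤ (gaussianReal 0 1).real (Metric.ball 0 r) := by
    simpa using mul_exp_le_gaussianReal_ball 0 hr0 hr1
  calc r / 4 * Real.exp (-1 / 2) = 1 / 2 * (r / 2 * Real.exp (-1 / 2)) := by ring
    _ ≤ 1 / 2 * gauss2.real (Prod.fst ⁻¹' Metric.ball 0 r) := by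
        rw [gauss2_real_fst]
        gcongr
    _ ≤ distOp n ρ (S.indicator 1) d := by
        rw [distOp_indicator_one]
        exact mul_le_equicorrLaw_real hmeas (measurable_fst measurableSet_ball) hcond

lemma distOp_indicator_Iio_one_le (hρ : ρ < 1) (hn : 1 ≤ n) {R : ℝ} (hR : 0 ≤ R) :
    distOp n ρ ((Set.Iio 1).indicator 1) 1 ≤
      2 * Real.exp (-R ^ 2 / 2) + Real.exp (-(growthRate (noiseRatio ρ * R) * √(n : ℝ))) := by
  have hone : ((1 : Fin (n + 1)) : ℝ) = 1 := by
    rw [Fin.val_one', Nat.mod_eq_of_lt (by omega), Nat.cast_one]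
  have hcond : ∀ ν ∈ (Prod.fst ⁻¹' Metric.closedBall (0 : ℝ) R : Set (ℝ × ℝ)),
      (Measure.pi fun _ : Fin n => shiftLaw ρ gauss2 ν).real {z | distStep z 1 ∈ Set.Iio 1} ≤
        Real.exp (-(growthRate (noiseRatio ρ * R) * √(n : ℝ))) := by
    intro ν hν
    rw [Set.mem_preimage, mem_closedBall_zero_iff, Real.norm_eq_abs] at hν
    have htail := pi_shiftLaw_distStep_le_le_exp hρ (1 : Fin (n + 1))
      (mul_le_mul_of_nonneg_left hν noiseRatio_nonneg)
    rw [hone, one_mul] at htail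
    refine (measureReal_mono fun z hz => ?_).trans htail
    have hzero : ((distStep z 1 : Fin (n + 1)) : ℕ) = 0 := by
      have hlt := Fin.lt_def.1 (Set.mem_Iio.1 hz)
      rw [Fin.val_one', Nat.mod_eq_of_lt (by omega)] at hlt
      omega
    rw [Set.mem_ofPred_eq, hzero, Nat.cast_zero]
    exact mul_nonneg (growthRate_pos _).le (Real.sqrt_nonneg _)
  rw [distOp_indicator_one]
  refine (equicorrLaw_real_le (measurableSet_distStep_mem _ _)
    (measurable_fst measurableSet_closedBall) (Real.exp_pos _).le hcond).trans ?_
  rw [← Set.preimage_compl, gauss2_real_fst]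
  gcongr
  exact gaussianReal_compl_closedBall_le hR

lemma gaussianReal_closedBall_four : 15 / 16 ≤ (gaussianReal 0 1).real (Metric.closedBall 0 4) := by
  have hexp : Real.exp (-4 ^ 2 / 2) ≤ 1 / 32 := by
    calc Real.exp (-4 ^ 2 / 2) = Real.exp (-1) ^ 8 := by rw [← Real.exp_nat_mul]; norm_num
      _ ≤ (1 / 2) ^ 8 := by gcongr; linarith [Real.exp_neg_one_lt_d9]
      _ ≤ 1 / 32 := by norm_num
  have htail := gaussianReal_compl_closedBall_le (r := 4) (by norm_num)
  rw [probReal_compl_eq_one_sub measurableSet_closedBall] at htail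
  linarith

lemma shiftLaw_crossing_ge {δ : ℝ} (hδ : 0 < δ) (hδρ : δ ≤ ρ) (hρ : ρ ≤ 1) {a α : ℝ} (hα : 0 < α)
    (ha : α ≤ a) {ν : ℝ × ℝ} (hν1 : |ν.1| < 1) (hν2 : (5 / √α + 5) / √δ < ν.2) :
    7 / 8 ≤ (shiftLaw ρ gauss2 ν).real (crossing a) := by
  have hα0 := Real.sqrt_pos.2 hα
  have : 0 < √δ := Real.sqrt_pos.2 hδ
  have hρ0 := Real.sqrt_nonneg ρ
  have hρ1 : √ρ ≤ 1 := Real.sqrt_le_one.2 hρ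
  have hs0 := Real.sqrt_nonneg (1 - ρ)
  have hs1 : √(1 - ρ) ≤ 1 := Real.sqrt_le_one.2 (by linarith)
  have hsub : Metric.closedBall 0 4 ×ˢ Metric.closedBall 0 4 ⊆
      {ψ : ℝ × ℝ | √ρ • ν + √(1 - ρ) • ψ ∈ crossing a} := by
    rintro ⟨ψ₁, ψ₂⟩ ⟨h1, h2⟩
    simp only [mem_closedBall_zero_iff, Real.norm_eq_abs] at h1 h2
    have hsmall : |√ρ * ν.1 + √(1 - ρ) * ψ₁| ≤ 5 := by
      calc |√ρ * ν.1 + √(1 - ρ) * ψ₁| ≤ √ρ * |ν.1| + √(1 - ρ) * |ψ₁| := by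
            refine (abs_add_le _ _).trans_eq ?_
            rw [abs_mul, abs_mul, abs_of_nonneg hρ0, abs_of_nonneg hs0]
        _ ≤ 1 * 1 + 1 * 4 := by gcongr
        _ = 5 := by norm_num
    have hlarge : 5 / √α + 1 ≤ √ρ * ν.2 + √(1 - ρ) * ψ₂ := by
      have hcommon : 5 / √α + 5 ≤ √ρ * ν.2 := by
        calc 5 / √α + 5 = √δ * ((5 / √α + 5) / √δ) := by field_simp
          _ ≤ √ρ * ν.2 := by gcongr
      have hindiv : -4 ≤ √(1 - ρ) * ψ₂ := by nlinarith [neg_abs_le ψ₂]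
      linarith
    refine mem_crossing_of_abs_lt (hα.le.trans ha) ?_
    calc |√ρ * ν.1 + √(1 - ρ) * ψ₁| < √α * (5 / √α + 1) := by
          rw [mul_add, mul_div_cancel₀ _ hα0.ne']
          linarith
      _ ≤ √a * |√ρ * ν.2 + √(1 - ρ) * ψ₂| := by
          gcongr
          exact hlarge.trans (le_abs_self _)
  rw [shiftLaw_real _ (measurableSet_crossing a)]
  refine le_trans ?_ (measureReal_mono hsub)
  rw [measureReal_prod_prod]
  nlinarith [gaussianReal_closedBall_four]

lemma exists_pos_le_distOp_indicator_compl_lowerHalf {δ α : ℝ} (hδ : 0 < δ) (hα : 0 < α) :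
    ∃ q > 0, ∀ (n : ℕ) (ρ : ℝ), 0 < n → δ ≤ ρ → ρ ≤ 1 → ∀ d : Fin (n + 1), α * n ≤ d →
      q ≤ distOp n ρ ((lowerHalf n)ᶜ.indicator 1) d := by
  set R := (5 / √α + 5) / √δ
  let Z : Set (ℝ × ℝ) := Metric.ball 0 1 ×ˢ Metric.ball (R + 1) 1
  have hball (c : ℝ) : 0 < (gaussianReal 0 1).real (Metric.ball c 1) :=
    (by positivity : 0 < 1 / 2 * Real.exp (-(|c| + 1) ^ 2 / 2)).trans_le
      (mul_exp_le_gaussianReal_ball c zero_le_one le_rfl)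
  have hZ : 0 < gauss2.real Z := by
    rw [measureReal_prod_prod]
    exact mul_pos (hball _) (hball _)
  refine ⟨3 / 4 * gauss2.real Z, by positivity, fun n ρ hn hδρ hρ d hd => ?_⟩
  rw [distOp_indicator_one]
  refine mul_le_equicorrLaw_real (measurableSet_distStep_mem _ _)
    (measurableSet_ball.prod measurableSet_ball) fun ν hν => ?_
  obtain ⟨hν1, hν2⟩ := hν
  rw [mem_ball_zero_iff, Real.norm_eq_abs] at hν1
  rw [Real.ball_eq_Ioo, Set.mem_Ioo] at hν2
  have hcross := shiftLaw_crossing_ge hδ hδρ hρ hα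
    ((le_div_iff₀ (by exact_mod_cast hn)).2 hd) hν1 (by linarith)
  have : Nonempty (Fin n) := ⟨⟨0, hn⟩⟩
  refine (pi_real_card_le_two_mul_hitCount (measurableSet_crossing _) hcross).trans
    (measureReal_mono fun z hz => ?_)
  rw [Set.mem_ofPred_eq, Fintype.card_fin] at hz
  exact fun hmem => (mem_lowerHalf.1 hmem).not_ge hz

end DistanceStep

section Climb

variable {n : ℕ} {ρ : ℝ}

/-- The levels of the climb from distance `1`: one layer typically takes a distance `d` beyond
a constant multiple of `√(d * n)`, so that `d / n` follows repeated square roots. -/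
def climbLevel (n i : ℕ) : Set (Fin (n + 1)) :=
  {d | growthRate 1 ^ 2 * n * (1 / 2) ^ 2 ^ i ≤ (d : ℝ)}

lemma one_mem_climbLevel (hn : 1 ≤ n) {k : ℕ} (hk : (n : ℝ) ≤ 2 ^ 2 ^ k) :
    1 ∈ climbLevel n k := by
  have hsq : growthRate 1 ^ 2 ≤ 1 := pow_le_one₀ (growthRate_pos 1).le (growthRate_le_one 1)
  rw [climbLevel, Set.mem_ofPred_eq, Fin.val_one', Nat.mod_eq_of_lt (by omega), Nat.cast_one]
  calc growthRate 1 ^ 2 * n * (1 / 2) ^ 2 ^ k ≤ 1 * 2 ^ 2 ^ k * (1 / 2) ^ 2 ^ k := by gcongr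
    _ = 1 := by rw [one_mul, ← mul_pow]; norm_num

lemma mem_climbLevel_of_le {i : ℕ} {d e : Fin (n + 1)} (hd : d ∈ climbLevel n (i + 1))
    (he : growthRate 1 * √((d : ℝ) * n) ≤ e) : e ∈ climbLevel n i := by
  have hg := growthRate_pos 1
  have hsqrt : growthRate 1 * n * (1 / 2) ^ 2 ^ i ≤ √((d : ℝ) * n) := by
    refine Real.le_sqrt_of_sq_le ?_
    calc _ = (growthRate 1 ^ 2 * n * (1 / 2) ^ 2 ^ (i + 1)) * n := by ring
      _ ≤ d * n := mul_le_mul_of_nonneg_right hd n.cast_nonneg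
  refine le_trans ?_ he
  calc growthRate 1 ^ 2 * n * (1 / 2) ^ 2 ^ i
      = growthRate 1 * (growthRate 1 * n * (1 / 2) ^ 2 ^ i) := by ring
    _ ≤ growthRate 1 * √((d : ℝ) * n) := by gcongr

lemma survival_distOp_le_of_climb (hρ : ρ < 1) (hn : 1 ≤ growthRate 1 * √(n : ℝ)) {q : ℝ}
    (hq : 0 ≤ q) (hexit : ∀ d : Fin (n + 1), growthRate 1 ^ 2 / 2 * n ≤ d →
      q ≤ distOp n ρ ((lowerHalf n)ᶜ.indicator 1) d)
    {r : ℝ} (hr0 : 0 ≤ r) (hr1 : r ≤ 1) (hr : noiseRatio ρ * r ≤ 1) {k : ℕ}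
    (hk : (n : ℝ) ≤ 2 ^ 2 ^ k) :
    survival (distOp n ρ) (lowerHalf n) (k + 1) 1 ≤ 1 - (r / 4 * Real.exp (-1 / 2)) ^ k * q := by
  have hg := growthRate_pos 1
  have hn0 : 0 < n := by
    refine Nat.pos_of_ne_zero fun h => ?_
    rw [h, Nat.cast_zero, Real.sqrt_zero, mul_zero] at hn
    linarith
  have hP : IsMarkov (distOp n ρ) := isMarkov_distOp
  refine hP.survival_le_of_levels (L := climbLevel n) (by positivity) hq
    (fun d hd => hexit d (le_trans (le_of_eq ?_) hd)) k (fun i _ d hd => ?_) 1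
    (one_mem_climbLevel hn0 hk)
  · ring
  · have hd1 : 1 ≤ (d : ℕ) := by
      have : (0 : ℝ) < d := lt_of_lt_of_le (by positivity) hd
      exact_mod_cast this
    refine (mul_le_distOp_indicator_sqrt hρ hd1 hn hr0 hr1 hr).trans (hP.monotone ?_ d)
    exact Set.indicator_le_indicator_of_subset (fun e he => mem_climbLevel_of_le hd he)
      fun _ => zero_le_one

end Climb

section Rates

variable {n : ℕ} {ρ l : ℝ}

lemma noiseRatio_sq_le (hl : 0 < l) (hρ0 : 0 ≤ ρ) (hρ : ρ < 1 - 4 * l ^ 3 / Real.exp l) :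
    noiseRatio ρ ^ 2 ≤ Real.exp l / (4 * l ^ 3) := by
  have hpos : 0 < 4 * l ^ 3 / Real.exp l := by positivity
  rw [noiseRatio, div_pow, Real.sq_sqrt hρ0, Real.sq_sqrt (by linarith)]
  calc ρ / (1 - ρ) ≤ 1 / (4 * l ^ 3 / Real.exp l) := by gcongr <;> linarith
    _ = Real.exp l / (4 * l ^ 3) := one_div_div _ _

lemma noiseRatio_mul_exp_le_one (hl : 1 ≤ l) (hρ0 : 0 ≤ ρ) (hρ : ρ < 1 - 4 * l ^ 3 / Real.exp l) :
    noiseRatio ρ * Real.exp (-l / 2) ≤ 1 := by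
  refine le_of_sq_le_sq ?_ zero_le_one
  calc (noiseRatio ρ * Real.exp (-l / 2)) ^ 2 = noiseRatio ρ ^ 2 * Real.exp (-l) := by
        rw [mul_pow, ← Real.exp_nat_mul]
        congr 2
        push_cast
        ring
    _ ≤ Real.exp l / (4 * l ^ 3) * Real.exp (-l) := by
        gcongr
        exact noiseRatio_sq_le (by linarith) hρ0 hρ
    _ = 1 / (4 * l ^ 3) := by
        rw [div_mul_eq_mul_div, ← Real.exp_add, add_neg_cancel, Real.exp_zero]
    _ ≤ 1 ^ 2 := by
        rw [one_pow, div_le_one (by positivity)]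
        linarith [one_le_pow₀ (n := 3) hl]

lemma natCast_le_two_pow_two_pow_ceil (hl : 10 ≤ l) (hlog : Real.log n = Real.exp l) :
    (n : ℝ) ≤ 2 ^ 2 ^ ⌈2 * l⌉₊ := by
  rcases n.eq_zero_or_pos with rfl | hn
  · simp
  have hceil : 2 * l ≤ ⌈2 * l⌉₊ := Nat.le_ceil _
  have hlog2 := Real.log_two_gt_d9
  have htwo : 2 * Real.exp l ≤ 2 ^ ⌈2 * l⌉₊ := by
    calc 2 * Real.exp l ≤ Real.exp 1 * Real.exp l := by
          gcongr
          linarith [Real.add_one_le_exp 1]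
      _ = Real.exp (1 + l) := (Real.exp_add _ _).symm
      _ ≤ Real.exp (⌈2 * l⌉₊ * Real.log 2) := Real.exp_le_exp.2 (by nlinarith)
      _ = 2 ^ ⌈2 * l⌉₊ := by rw [Real.exp_nat_mul, Real.exp_log two_pos]
  rw [← Real.log_le_log_iff (by exact_mod_cast hn) (by positivity), hlog, Real.log_pow]
  push_cast
  nlinarith [Real.exp_pos l]

lemma exp_le_climb_pow_ceil (hl : 0 ≤ l) :
    Real.exp (-(l ^ 2 + 5 * l + 5)) ≤
      (Real.exp (-l / 2) / 4 * Real.exp (-1 / 2)) ^ ⌈2 * l⌉₊ := by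
  have hceil : (⌈2 * l⌉₊ : ℝ) < 2 * l + 1 := Nat.ceil_lt_add_one (by linarith)
  have hquarter : Real.exp (-3 / 2) ≤ 1 / 4 := by
    calc Real.exp (-3 / 2) = (Real.exp (1 / 2) ^ 3)⁻¹ := by
          rw [← Real.exp_nat_mul, ← Real.exp_neg]
          norm_num
      _ ≤ ((1 + 1 / 2 + (1 / 2) ^ 2 / 2) ^ 3)⁻¹ := by
          gcongr
          exact Real.quadratic_le_exp_of_nonneg one_half_pos.le
      _ ≤ 1 / 4 := by norm_num
  calc Real.exp (-(l ^ 2 + 5 * l + 5)) ≤ Real.exp (⌈2 * l⌉₊ * (-l / 2 + -3 / 2 + -1 / 2)) :=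
        Real.exp_le_exp.2 (by nlinarith)
    _ = (Real.exp (-l / 2) * Real.exp (-3 / 2) * Real.exp (-1 / 2)) ^ ⌈2 * l⌉₊ := by
        rw [Real.exp_nat_mul, Real.exp_add, Real.exp_add]
    _ ≤ (Real.exp (-l / 2) / 4 * Real.exp (-1 / 2)) ^ ⌈2 * l⌉₊ := by
        rw [div_eq_mul_one_div (Real.exp (-l / 2))]
        gcongr

lemma ceil_exp_mul_ceil_add_one_le (hl : 10 ≤ l) :
    (⌈Real.exp (2 * l ^ 2)⌉₊ : ℝ) * (⌈2 * l⌉₊ + 1) ≤ Real.exp (3 * l ^ 2) := by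
  have hk : (⌈2 * l⌉₊ : ℝ) < 2 * l + 1 := Nat.ceil_lt_add_one (by linarith)
  have hm := Nat.ceil_lt_add_one (Real.exp_pos (2 * l ^ 2)).le
  have hone : 1 ≤ Real.exp (2 * l ^ 2) := Real.one_le_exp (by positivity)
  calc (⌈Real.exp (2 * l ^ 2)⌉₊ : ℝ) * (⌈2 * l⌉₊ + 1)
      ≤ (2 * Real.exp (2 * l ^ 2)) * (2 * l + 1 + 1) := by gcongr; linarith
    _ = Real.exp (2 * l ^ 2) * (4 * l + 4) := by ring
    _ ≤ Real.exp (2 * l ^ 2) * Real.exp (l ^ 2) := by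
        gcongr
        nlinarith [Real.add_one_le_exp (l ^ 2)]
    _ = Real.exp (3 * l ^ 2) := by rw [← Real.exp_add]; ring_nf

/-- The exponential rate in the bound for the probability that two inputs at distance `1`
merge. -/
def mergeRate : ℝ := Real.exp (-9 / 2) / 16 * Real.exp (-1)

lemma mergeRate_pos : 0 < mergeRate := by
  unfold mergeRate
  positivity

lemma mergeRate_mul_exp_le (hl : 10 ≤ l) (hρ0 : 0 ≤ ρ) (hρ : ρ < 1 - 4 * l ^ 3 / Real.exp l) :
    mergeRate * Real.exp l ≤ growthRate (noiseRatio ρ * (3 * l)) * Real.exp (Real.exp l / 2) := by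
  have hl0 : 0 < l := by linarith
  set κ := noiseRatio ρ
  have hratio : κ ^ 2 * (9 * l ^ 2) ≤ Real.exp l / 4 := by
    calc κ ^ 2 * (9 * l ^ 2) ≤ Real.exp l / (4 * l ^ 3) * (9 * l ^ 2) := by
          gcongr
          exact noiseRatio_sq_le hl0 hρ0 hρ
      _ = Real.exp l / 4 * (9 / l) := by field_simp
      _ ≤ Real.exp l / 4 * 1 := by
          gcongr
          rw [div_le_one hl0]
          linarith
      _ = Real.exp l / 4 := mul_one _
  have hsq : (κ * (3 * l) + 1) ^ 2 ≤ 2 * (κ ^ 2 * (9 * l ^ 2)) + 2 := by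
    nlinarith [sq_nonneg (κ * (3 * l) - 1)]
  have hle : l ≤ Real.exp l / 4 := by nlinarith [Real.quadratic_le_exp_of_nonneg hl0.le]
  calc mergeRate * Real.exp l = Real.exp (-9 / 2) / 16 * Real.exp (-1 + l) := by
        rw [mergeRate, Real.exp_add, mul_assoc]
    _ ≤ Real.exp (-9 / 2) / 16 * Real.exp (-(κ * (3 * l) + 1) ^ 2 / 2 + Real.exp l / 2) := by
        refine mul_le_mul_of_nonneg_left (Real.exp_le_exp.2 ?_) (by positivity)
        linarith
    _ = growthRate (κ * (3 * l)) * Real.exp (Real.exp l / 2) := by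
        rw [growthRate, Real.exp_add, mul_assoc]

lemma distOp_indicator_Iio_one_le_of_log (hl : 10 ≤ l) (hlog : Real.log n = Real.exp l)
    (hn : 1 ≤ n) (hρ0 : 0 ≤ ρ) (hρ : ρ < 1 - 4 * l ^ 3 / Real.exp l) :
    distOp n ρ ((Set.Iio 1).indicator 1) 1 ≤
      2 * Real.exp (-(4 * l ^ 2)) + Real.exp (-(mergeRate * Real.exp l)) := by
  have hρ1 : ρ < 1 := by
    have : 0 < 4 * l ^ 3 / Real.exp l := by positivity
    linarith
  have hsqrt : √(n : ℝ) = Real.exp (Real.exp l / 2) := by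
    rw [Real.sqrt_eq_rpow, Real.rpow_def_of_pos (by exact_mod_cast hn), hlog, mul_one_div]
  refine (distOp_indicator_Iio_one_le hρ1 hn (R := 3 * l) (by linarith)).trans ?_
  rw [hsqrt]
  have hgauss : -(3 * l) ^ 2 / 2 ≤ -(4 * l ^ 2) := by nlinarith
  exact add_le_add (by gcongr) (Real.exp_le_exp.2 (neg_le_neg (mergeRate_mul_exp_le hl hρ0 hρ)))

end Rates

section Survival

variable {n : ℕ} {ρ l q : ℝ}

/-- A bound on the probability that the distance chain started at `1` stays in the lower half:
the first term bounds the probability that each of `exp (2 * l ^ 2)` climbs from `1` fails, the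
second the probability that the two inputs merge, where `l = log (log n)`. -/
def survivalBound (q l : ℝ) : ℝ :=
  Real.exp (-(q * Real.exp (l ^ 2 - 5 * l - 5))) +
    (2 * Real.exp (-l ^ 2) + Real.exp (3 * l ^ 2 - mergeRate * Real.exp l))

lemma pow_ceil_exp_le_exp (hq : 0 ≤ q) {s : ℝ} (hs0 : 0 ≤ s)
    (hs : s ≤ 1 - Real.exp (-(l ^ 2 + 5 * l + 5)) * q) :
    s ^ ⌈Real.exp (2 * l ^ 2)⌉₊ ≤ Real.exp (-(q * Real.exp (l ^ 2 - 5 * l - 5))) := by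
  set c := q * Real.exp (-(l ^ 2 + 5 * l + 5))
  calc s ^ ⌈Real.exp (2 * l ^ 2)⌉₊ ≤ Real.exp (-c) ^ ⌈Real.exp (2 * l ^ 2)⌉₊ := by
        gcongr
        linarith [Real.add_one_le_exp (-c)]
    _ = Real.exp (-(⌈Real.exp (2 * l ^ 2)⌉₊ * c)) := by rw [← Real.exp_nat_mul, mul_neg]
    _ ≤ Real.exp (-(Real.exp (2 * l ^ 2) * c)) := by
        gcongr
        exact Nat.le_ceil _
    _ = Real.exp (-(q * Real.exp (l ^ 2 - 5 * l - 5))) := by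
        rw [mul_left_comm, ← Real.exp_add]
        ring_nf

lemma survival_distOp_le_survivalBound (hl : 10 ≤ l) (hlog : Real.log n = Real.exp l) (hn : 1 ≤ n)
    (hgrow : 1 ≤ growthRate 1 * √(n : ℝ)) (hρ0 : 0 ≤ ρ) (hρ : ρ < 1 - 4 * l ^ 3 / Real.exp l)
    (hq : 0 ≤ q) (hexit : ∀ d : Fin (n + 1), growthRate 1 ^ 2 / 2 * n ≤ d →
      q ≤ distOp n ρ ((lowerHalf n)ᶜ.indicator 1) d)
    {t : ℕ} (ht : Real.exp (3 * l ^ 2) ≤ t) :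
    survival (distOp n ρ) (lowerHalf n) t 1 ≤ survivalBound q l := by
  have hρ1 : ρ < 1 := by
    have : 0 < 4 * l ^ 3 / Real.exp l := by positivity
    linarith
  have hP : IsMarkov (distOp n ρ) := isMarkov_distOp
  set k := ⌈2 * l⌉₊
  set m := ⌈Real.exp (2 * l ^ 2)⌉₊
  have htime := ceil_exp_mul_ceil_add_one_le hl
  have hclimb : survival (distOp n ρ) (lowerHalf n) (k + 1) 1 ≤
      1 - Real.exp (-(l ^ 2 + 5 * l + 5)) * q := by
    refine (survival_distOp_le_of_climb hρ1 hgrow hq hexit (Real.exp_pos (-l / 2)).le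
      (Real.exp_le_one_iff.2 (by linarith)) (noiseRatio_mul_exp_le_one (by linarith) hρ0 hρ)
      (natCast_le_two_pow_two_pow_ceil hl hlog)).trans ?_
    gcongr
    exact exp_le_climb_pow_ceil (by linarith)
  calc survival (distOp n ρ) (lowerHalf n) t 1
      ≤ survival (distOp n ρ) (lowerHalf n) (m * (k + 1)) 1 :=
        hP.survival_antitone_time (by exact_mod_cast htime.trans ht) 1
    _ ≤ survival (distOp n ρ) (lowerHalf n) (k + 1) 1 ^ m +
          m * ↑(k + 1) * distOp n ρ ((Set.Iio 1).indicator 1) 1 :=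
        survival_mul_le hP isStochasticallyMonotone_distOp isLowerSet_lowerHalf 1 m (k + 1)
    _ ≤ Real.exp (-(q * Real.exp (l ^ 2 - 5 * l - 5))) + Real.exp (3 * l ^ 2) *
          (2 * Real.exp (-(4 * l ^ 2)) + Real.exp (-(mergeRate * Real.exp l))) := by
        push_cast
        gcongr
        · exact pow_ceil_exp_le_exp hq (hP.survival_nonneg _ _) hclimb
        · exact hP.map_nonneg (Set.indicator_nonneg fun _ _ => zero_le_one) 1
        · exact distOp_indicator_Iio_one_le_of_log hl hlog hn hρ0 hρ
    _ = survivalBound q l := by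
        rw [survivalBound, mul_add, mul_left_comm, ← Real.exp_add, ← Real.exp_add]
        ring_nf

lemma tendsto_mergeRate_mul_exp_sub_sq :
    Tendsto (fun l : ℝ => mergeRate * Real.exp l - 3 * l ^ 2) atTop atTop := by
  refine tendsto_atTop_mono' atTop ?_ (tendsto_pow_atTop (α := ℝ) (n := 2) two_ne_zero)
  filter_upwards [(Real.tendsto_exp_div_pow_atTop 2).eventually_ge_atTop (4 / mergeRate),
    eventually_gt_atTop 0] with l hl hl0
  rw [div_le_div_iff₀ mergeRate_pos (by positivity)] at hl
  linarith

lemma tendsto_survivalBound (hq : 0 < q) : Tendsto (survivalBound q) atTop (𝓝 0) := by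
  have hexponent : Tendsto (fun l : ℝ => l ^ 2 - 5 * l - 5) atTop atTop := by
    refine tendsto_atTop_mono' atTop ?_ tendsto_id
    filter_upwards [eventually_ge_atTop 10] with l hl
    rw [id]
    nlinarith
  have hclimb : Tendsto (fun l : ℝ => Real.exp (-(q * Real.exp (l ^ 2 - 5 * l - 5)))) atTop (𝓝 0) :=
    Real.tendsto_exp_neg_atTop_nhds_zero.comp
      ((Real.tendsto_exp_atTop.comp hexponent).const_mul_atTop hq)
  have htail : Tendsto (fun l : ℝ => Real.exp (-l ^ 2)) atTop (𝓝 0) :=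
    Real.tendsto_exp_neg_atTop_nhds_zero.comp (tendsto_pow_atTop two_ne_zero)
  have hmerge : Tendsto (fun l : ℝ => Real.exp (3 * l ^ 2 - mergeRate * Real.exp l)) atTop (𝓝 0) :=
    (Real.tendsto_exp_neg_atTop_nhds_zero.comp tendsto_mergeRate_mul_exp_sub_sq).congr fun l => by
      rw [Function.comp_apply, neg_sub]
  have hsum := hclimb.add ((htail.const_mul 2).add hmerge)
  rwa [mul_zero, add_zero, add_zero] at hsum

theorem tendsto_survival_distOp {δ : ℝ} {ρ : ℕ → ℝ} {T : ℕ → ℕ} (hδ : 0 < δ)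
    (hρ : ∀ᶠ n : ℕ in atTop, δ < ρ n ∧ ρ n < 1 - 4 * Real.log (Real.log n) ^ 3 / Real.log n)
    (hT : ∀ᶠ n : ℕ in atTop, Real.exp (4 * Real.log (Real.log n) ^ 2) ≤ (T n : ℝ)) :
    Tendsto (fun n => survival (distOp n (ρ n)) (lowerHalf n) (T n - 1) 1) atTop (𝓝 0) := by
  obtain ⟨q, hq, hexit⟩ := exists_pos_le_distOp_indicator_compl_lowerHalf hδ
    (α := growthRate 1 ^ 2 / 2) (half_pos (pow_pos (growthRate_pos 1) 2))
  have hlog : Tendsto (fun n : ℕ => Real.log n) atTop atTop :=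
    Real.tendsto_log_atTop.comp tendsto_natCast_atTop_atTop
  have hloglog : Tendsto (fun n : ℕ => Real.log (Real.log n)) atTop atTop :=
    Real.tendsto_log_atTop.comp hlog
  have hgrow : Tendsto (fun n : ℕ => growthRate 1 * √(n : ℝ)) atTop atTop :=
    (Real.tendsto_sqrt_atTop.comp tendsto_natCast_atTop_atTop).const_mul_atTop (growthRate_pos 1)
  refine squeeze_zero' (Eventually.of_forall fun n => isMarkov_distOp.survival_nonneg _ _) ?_
    ((tendsto_survivalBound hq).comp hloglog)
  filter_upwards [hρ, hT, hloglog.eventually_ge_atTop 10, hlog.eventually_gt_atTop 0,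
    hgrow.eventually_ge_atTop 1, eventually_ge_atTop 1] with n ⟨hδρ, hρ1⟩ hTn hl hlog0 hg hn
  have hexp := Real.exp_log hlog0
  rw [← hexp, Real.log_exp] at hρ1
  set l := Real.log (Real.log n)
  have hpos : 0 < 4 * l ^ 3 / Real.exp l := by positivity
  refine survival_distOp_le_survivalBound hl hexp.symm hn hg (hδ.trans hδρ).le hρ1 hq.le
    (fun d hd => hexit n (ρ n) hn hδρ.le (by linarith) d hd) ?_
  have hstep : Real.exp (3 * l ^ 2) + 1 ≤ Real.exp (4 * l ^ 2) := by
    have hsplit : Real.exp (4 * l ^ 2) = Real.exp (3 * l ^ 2) * Real.exp (l ^ 2) := by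
      rw [← Real.exp_add]
      ring_nf
    have hone : 1 ≤ Real.exp (3 * l ^ 2) := Real.one_le_exp (by positivity)
    nlinarith [Real.add_one_le_exp (l ^ 2)]
  rw [Nat.cast_pred (by exact_mod_cast (Real.exp_pos _).trans_le hTn)]
  linarith

end Survival

section Network

variable {n T : ℕ} {ρ : ℝ}

instance : IsProbabilityMeasure (weightLaw n T ρ) :=
  inferInstanceAs (IsProbabilityMeasure (Measure.pi _))

@[fun_prop]
lemma measurable_layer_uncurry :
    Measurable fun p : (Fin n → Fin n → ℝ) × Cube n => layer p.1 p.2 :=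
  measurable_from_prod_countable_left measurable_layer

@[fun_prop]
lemma measurable_hiddenState (x : Cube n) :
    Measurable fun θ : Fin T → Fin n → Fin n → ℝ => hiddenState T θ x := by
  induction T with
  | zero => exact measurable_const
  | succ T ih =>
    have hinit : Measurable fun (θ : Fin (T + 1) → Fin n → Fin n → ℝ) (t : Fin T) =>
        θ t.castSucc := by fun_prop
    exact measurable_layer_uncurry.comp
      ((measurable_pi_apply (Fin.last T)).prodMk (ih.comp hinit))

/-- The transition operator of the chain which applies the same random layer to two inputs. -/
def pairOp (n : ℕ) (ρ : ℝ) : Module.End ℝ (Cube n × Cube n → ℝ) :=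
  randomMapOp (layerLaw n ρ) (fun W p => (layer W p.1, layer W p.2)) fun p => by fun_prop

lemma isMarkov_pairOp : IsMarkov (pairOp n ρ) := isMarkov_randomMapOp

lemma integral_hiddenState_succ (F : Cube n × Cube n → ℝ) (x y : Cube n) :
    ∫ θ, F (hiddenState (T + 1) θ x, hiddenState (T + 1) θ y) ∂weightLaw n (T + 1) ρ =
      ∫ θ, pairOp n ρ F (hiddenState T θ x, hiddenState T θ y) ∂weightLaw n T ρ := by
  let G (p : (Fin n → Fin n → ℝ) × (Fin T → Fin n → Fin n → ℝ)) : Cube n × Cube n :=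
    (layer p.1 (hiddenState T p.2 x), layer p.1 (hiddenState T p.2 y))
  have hG : Measurable G :=
    (measurable_layer_uncurry.comp (measurable_fst.prodMk (by fun_prop))).prodMk
      (measurable_layer_uncurry.comp (measurable_fst.prodMk (by fun_prop)))
  have hsplit := (measurePreserving_piFinSuccAbove (fun _ : Fin (T + 1) => layerLaw n ρ)
    (Fin.last T)).integral_comp' fun p => F (G p)
  have hremove (θ : Fin (T + 1) → Fin n → Fin n → ℝ) :
      (Fin.last T).removeNth θ = fun t => θ t.castSucc := by
    ext t
    simp [Fin.removeNth]
  simp only [MeasurableEquiv.piFinSuccAbove_apply, Fin.insertNthEquiv_symm_apply, hremove] at hsplit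
  exact hsplit.trans (integral_prod_symm _ (integrable_comp_of_finite hG F))

lemma integral_hiddenState (F : Cube n × Cube n → ℝ) (x y : Cube n) :
    ∫ θ, F (hiddenState T θ x, hiddenState T θ y) ∂weightLaw n T ρ = (pairOp n ρ ^ T) F (x, y) := by
  induction T generalizing F with
  | zero => simp [hiddenState]
  | succ T ih => rw [integral_hiddenState_succ, ih, pow_succ, Module.End.mul_apply]

lemma pow_pairOp_comp_cubeDist (hn : 0 < n) (t : ℕ) (g : Fin (n + 1) → ℝ) :
    (pairOp n ρ ^ t) (g ∘ Function.uncurry cubeDist) =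
      (distOp n ρ ^ t) g ∘ Function.uncurry cubeDist :=
  pow_apply_comp (fun f => funext fun p => integral_cubeDist_layer hn f p.1 p.2) t g

lemma integral_layer_odd (hρ : ρ < 1) {f : Cube n → ℝ} (hf : Function.Odd f) (x : Cube n) :
    ∫ W, f (layer W x) ∂layerLaw n ρ = 0 := by
  have hlaw : ∀ y : Cube n, ∫ W, f (layer W y) ∂layerLaw n ρ =
      ∫ z, f (fun i => sgn (√(n : ℝ) * z i)) ∂equicorrLaw (Fin n) ρ (gaussianReal 0 1) := by
    intro y
    have hF : Measurable fun z : Fin n → ℝ => f fun i => sgn (z i) :=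
      (measurable_of_finite f).comp (by fun_prop)
    have hmap := congrArg (fun μ => ∫ z, f (fun i => sgn (z i)) ∂μ) (map_layerLaw_dotCLM (ρ := ρ) y)
    rw [integral_map (Measurable.aemeasurable (by fun_prop)) hF.aestronglyMeasurable,
      integral_map (Measurable.aemeasurable (by fun_prop)) hF.aestronglyMeasurable] at hmap
    rw [← hmap]
    simp only [← layer_apply]
  have hneg : ∫ W, f (layer W (-x)) ∂layerLaw n ρ = -∫ W, f (layer W x) ∂layerLaw n ρ := by
    rw [← integral_neg]
    refine integral_congr_ae ?_
    filter_upwards [ae_dotCLM_row_ne_zero hρ x] with W hW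
    rw [layer_neg hW, hf]
  rw [hlaw, ← hlaw x] at hneg
  linarith

/-- A Boolean function as a real-valued function. -/
def realOf (h : Cube n → ℤˣ) (x : Cube n) : ℝ := ((h x : ℤ) : ℝ)

lemma odd_realOf {h : Cube n → ℤˣ} (hh : Function.Odd h) : Function.Odd (realOf h) := fun x => by
  simp [realOf, hh x]

lemma realOf_mul_self (h : Cube n → ℤˣ) (x : Cube n) : realOf h x * realOf h x = 1 := by
  rcases Int.units_eq_one_or (h x) with hx | hx <;> simp [realOf, hx]

lemma abs_realOf (h : Cube n → ℤˣ) (x : Cube n) : |realOf h x| = 1 := by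
  rcases Int.units_eq_one_or (h x) with hx | hx <;> simp [realOf, hx]

lemma integral_netReal (hρ : ρ < 1) {h : Cube n → ℤˣ} (hh : Function.Odd h) (hT : 0 < T)
    (x : Cube n) : ∫ θ, netReal h θ x ∂weightLaw n T ρ = 0 := by
  obtain ⟨T, rfl⟩ := Nat.exists_eq_succ_of_ne_zero hT.ne'
  have hzero : pairOp n ρ (realOf h ∘ Prod.fst) = 0 :=
    funext fun p => integral_layer_odd hρ (odd_realOf hh) p.1
  have hsucc := integral_hiddenState_succ (T := T) (ρ := ρ) (realOf h ∘ Prod.fst) x x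
  rw [hzero] at hsucc
  exact hsucc.trans (by simp)

/-- The product of the values of a Boolean function at two points. -/
def pairProd (h : Cube n → ℤˣ) (p : Cube n × Cube n) : ℝ := realOf h p.1 * realOf h p.2

lemma abs_pairProd (h : Cube n → ℤˣ) (p : Cube n × Cube n) : |pairProd h p| = 1 := by
  rw [pairProd, abs_mul, abs_realOf, abs_realOf, one_mul]

/-- The correlation of the outputs of the network at two inputs. -/
def pairCorr (ρ : ℝ) (T : ℕ) (h : Cube n → ℤˣ) (x y : Cube n) : ℝ :=
  ∫ θ, netReal h θ x * netReal h θ y ∂weightLaw n T ρ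

lemma pairCorr_eq (h : Cube n → ℤˣ) (x y : Cube n) :
    pairCorr ρ T h x y = (pairOp n ρ ^ T) (pairProd h) (x, y) :=
  integral_hiddenState (pairProd h) x y

lemma abs_pairCorr_le_one (h : Cube n → ℤˣ) (x y : Cube n) : |pairCorr ρ T h x y| ≤ 1 := by
  rw [pairCorr_eq]
  exact (isMarkov_pairOp.pow T).abs_le_one (fun p => (abs_pairProd h p).le) (x, y)

end Network

section DistanceApproximation

variable {n : ℕ} {ρ : ℝ}

lemma cubeDist_pos {x y : Cube n} (h : y ≠ x) : 1 ≤ cubeDist x y := by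
  have hpos := hammingDist_pos.2 h.symm
  rw [Fin.le_def, Fin.val_one']
  exact (Nat.mod_le 1 (n + 1)).trans hpos

lemma pos_of_ne {x y : Cube n} (h : y ≠ x) : 0 < n :=
  Nat.pos_of_ne_zero fun hn => h (by subst hn; exact Subsingleton.elim y x)

/-- Symmetrization and stochastic monotonicity of the distance chain: the correlation of two
inputs is positive only as long as their distance has stayed below `n / 2`. -/
lemma abs_pow_pairOp_le (hρ : ρ < 1) {g : Fin (n + 1) → ℝ} (hg : Antitone g)
    (hodd : ∀ d, g d.rev = -g d) (hg1 : g ≤ 1) {F u : Cube n × Cube n → ℝ}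
    (hF : ∀ p, |F p - g (cubeDist p.1 p.2)| ≤ u p) (t : ℕ) {x y : Cube n} (hxy : y ≠ x)
    (hxy' : y ≠ -x) :
    |(pairOp n ρ ^ t) F (x, y)| ≤
      survival (distOp n ρ) (lowerHalf n) t 1 + (pairOp n ρ ^ t) u (x, y) := by
  have hn : 0 < n := pos_of_ne hxy
  have hrev : 1 ≤ (cubeDist x y).rev := by
    rw [← cubeDist_neg_right]
    exact cubeDist_pos fun h => hxy' (neg_eq_iff_eq_neg.1 h)
  have hdist : |(distOp n ρ ^ t) g (cubeDist x y)| ≤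
      survival (distOp n ρ) (lowerHalf n) t 1 :=
    abs_pow_apply_le_survival (distOp_comp_rev hn hρ) hodd isMarkov_distOp
      isStochasticallyMonotone_distOp hg isLowerSet_lowerHalf hg1 t (cubeDist_pos hxy) hrev
  have happrox : |(pairOp n ρ ^ t) F (x, y) - (distOp n ρ ^ t) g (cubeDist x y)| ≤
      (pairOp n ρ ^ t) u (x, y) := by
    have := ((isMarkov_pairOp (n := n) (ρ := ρ)).pow t).abs_sub_le
      (g := g ∘ Function.uncurry cubeDist) hF (x, y)
    rwa [pow_pairOp_comp_cubeDist hn] at this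
  linarith [abs_sub_abs_le_abs_sub ((pairOp n ρ ^ t) F (x, y))
    ((distOp n ρ ^ t) g (cubeDist x y))]

end DistanceApproximation

section Absorption

variable {n T : ℕ} {ρ : ℝ}

/-- A convex cone of pairs at which the two correlated Gaussians of a pair of inputs at distance
at most `n / 2` are both positive. -/
def forwardCone : Set (ℝ × ℝ) := {p | |p.2| < p.1}

lemma measurableSet_forwardCone : MeasurableSet forwardCone :=
  measurableSet_lt (by fun_prop) (by fun_prop)

lemma smul_add_smul_mem_forwardCone {p q : ℝ × ℝ} (hp : p ∈ forwardCone) (hq : q ∈ forwardCone)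
    {s t : ℝ} (hs : 0 ≤ s) (ht : 0 < t) : s • p + t • q ∈ forwardCone := by
  calc |s * p.2 + t * q.2| ≤ s * |p.2| + t * |q.2| := by
        simpa only [abs_mul, abs_of_nonneg hs, abs_of_pos ht] using abs_add_le (s * p.2) (t * q.2)
    _ < s * p.1 + t * q.1 :=
        add_lt_add_of_le_of_lt (mul_le_mul_of_nonneg_left (le_of_lt hp) hs)
          (mul_lt_mul_of_pos_left hq ht)

lemma notMem_crossing_of_mem_forwardCone {a : ℝ} (ha : a ≤ 1 / 2) {z : ℝ × ℝ}
    (hz : z ∈ forwardCone) : z ∉ crossing a := fun hcross => by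
  have hle := abs_le_of_add_sub_mem_discord hcross
  change |√(1 - a) * z.1| ≤ |√a * z.2| at hle
  rw [abs_mul, abs_mul, abs_of_nonneg (Real.sqrt_nonneg _), abs_of_nonneg (Real.sqrt_nonneg _)]
    at hle
  have hsqrt : √a ≤ √(1 - a) := Real.sqrt_le_sqrt (by linarith)
  have hpos : 0 < √(1 - a) := Real.sqrt_pos.2 (by linarith)
  have hlt : |z.2| < |z.1| := lt_of_lt_of_le hz (le_abs_self _)
  linarith [mul_le_mul_of_nonneg_right hsqrt (abs_nonneg z.2), mul_lt_mul_of_pos_left hlt hpos]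

lemma gauss2_real_forwardCone_pos : 0 < gauss2.real forwardCone := by
  have hball (c : ℝ) : 0 < (gaussianReal 0 1).real (Metric.ball c 1) :=
    lt_of_lt_of_le (by positivity) (mul_exp_le_gaussianReal_ball c zero_le_one le_rfl)
  calc 0 < gauss2.real (Metric.ball 2 1 ×ˢ Metric.ball 0 1) := by
        rw [measureReal_prod_prod]
        exact mul_pos (hball 2) (hball 0)
    _ ≤ gauss2.real forwardCone := measureReal_mono fun z ⟨hz1, hz2⟩ => by
        rw [Real.ball_eq_Ioo, Set.mem_Ioo] at hz1 hz2
        exact (abs_lt.2 ⟨by linarith, by linarith⟩ : |z.2| < 1).trans (by linarith)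

/-- A lower bound for the probability that two points of the cube at distance at most `n / 2` are
merged by the next layer. -/
def absorptionProb (n : ℕ) : ℝ := gauss2.real forwardCone ^ (n + 1)

lemma absorptionProb_pos : 0 < absorptionProb n := pow_pos gauss2_real_forwardCone_pos _

lemma absorptionProb_le_one : absorptionProb n ≤ 1 :=
  pow_le_one₀ measureReal_nonneg measureReal_le_one

lemma distStep_eq_zero {z : Fin n → ℝ × ℝ} {d : Fin (n + 1)}
    (hz : ∀ i, z i ∉ crossing (d / n)) : distStep z d = 0 :=
  Fin.ext <| by simp [distStep, hitCountFin, hitCount, hz]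

lemma distStep_zero (z : Fin n → ℝ × ℝ) : distStep z 0 = 0 :=
  distStep_eq_zero fun i => by simp [crossing, discord, correlate_apply]

lemma absorptionProb_le_distOp_indicator_zero (hρ : ρ < 1) {d : Fin (n + 1)}
    (hd : 2 * (d : ℕ) ≤ n) :
    absorptionProb n ≤ distOp n ρ (({0} : Set (Fin (n + 1))).indicator 1) d := by
  have ha : (d : ℝ) / n ≤ 1 / 2 := by
    refine div_le_of_le_mul₀ n.cast_nonneg (by norm_num) ?_
    have : (2 * (d : ℕ) : ℝ) ≤ n := by exact_mod_cast hd
    linarith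
  have hcone : ∀ ν ∈ forwardCone,
      gauss2.real forwardCone ≤ (shiftLaw ρ gauss2 ν).real forwardCone := fun ν hν => by
    rw [shiftLaw_real ν measurableSet_forwardCone]
    exact measureReal_mono fun ψ hψ =>
      smul_add_smul_mem_forwardCone hν hψ (Real.sqrt_nonneg ρ) (Real.sqrt_pos.2 (by linarith))
  rw [distOp_indicator_one, absorptionProb, pow_succ]
  refine mul_le_equicorrLaw_real (measurableSet_distStep_mem _ d) measurableSet_forwardCone
    fun ν hν => ?_
  calc gauss2.real forwardCone ^ n ≤ (shiftLaw ρ gauss2 ν).real forwardCone ^ n :=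
        pow_le_pow_left₀ measureReal_nonneg (hcone ν hν) n
    _ = (Measure.pi fun _ : Fin n => shiftLaw ρ gauss2 ν).real
          (Set.univ.pi fun _ => forwardCone) := by
        simp [Measure.real, Measure.pi_pi]
    _ ≤ _ := measureReal_mono fun z hz => distStep_eq_zero fun i =>
        notMem_crossing_of_mem_forwardCone ha (hz i trivial)

lemma distOp_indicator_Ioo_le_of_two_mul_le (hρ : ρ < 1) {d : Fin (n + 1)}
    (hd : 2 * (d : ℕ) ≤ n) :
    distOp n ρ ((Set.Ioo 0 (Fin.last n)).indicator 1) d ≤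
      (1 - absorptionProb n) * (Set.Ioo 0 (Fin.last n)).indicator 1 d := by
  rcases eq_or_ne d 0 with rfl | hd0
  · simp [distOp_indicator_one, distStep_zero]
  have hmem : d ∈ Set.Ioo 0 (Fin.last n) := by
    have hpos := Fin.lt_def.1 (Fin.pos_iff_ne_zero.2 hd0)
    refine ⟨hpos, Fin.lt_def.2 ?_⟩
    rw [Fin.val_last]
    omega
  have hle : (Set.Ioo 0 (Fin.last n)).indicator 1 ≤
      (1 : Fin (n + 1) → ℝ) - ({0} : Set (Fin (n + 1))).indicator 1 := by
    rw [← Set.indicator_compl]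
    exact Set.indicator_le_indicator_of_subset (fun e he => he.1.ne') fun _ => zero_le_one
  have hstep := (isMarkov_distOp (ρ := ρ)).monotone hle d
  rw [map_sub, isMarkov_distOp.map_one, Pi.sub_apply, Pi.one_apply] at hstep
  rw [Set.indicator_of_mem hmem, Pi.one_apply, mul_one]
  linarith [absorptionProb_le_distOp_indicator_zero hρ hd]

lemma distOp_indicator_Ioo_le (hρ : ρ < 1) :
    distOp n ρ ((Set.Ioo 0 (Fin.last n)).indicator 1) ≤
      (1 - absorptionProb n) • (Set.Ioo 0 (Fin.last n)).indicator 1 := by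
  intro d
  rcases le_or_gt (2 * (d : ℕ)) n with hd | hd
  · exact distOp_indicator_Ioo_le_of_two_mul_le hρ hd
  set u : Fin (n + 1) → ℝ := (Set.Ioo 0 (Fin.last n)).indicator 1 with hu
  have hrev : u ∘ Fin.rev = u := funext fun e => by
    rw [Function.comp_apply, hu, ← Set.indicator_comp_right, Fin.preimage_rev_Ioo, Fin.rev_last,
      Fin.rev_zero]
    rfl
  have hcomm := distOp_comp_rev (by omega) hρ u
  rw [hrev] at hcomm
  have hsymm := distOp_indicator_Ioo_le_of_two_mul_le hρ
    (show 2 * (d.rev : ℕ) ≤ n by rw [Fin.val_rev]; omega)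
  rw [← hu, ← Function.comp_apply (f := u), hrev, ← Function.comp_apply (f := distOp n ρ u),
    ← hcomm] at hsymm
  exact hsymm

/-- A depth after which, for every correlation `ρ`, two inputs of width `n` have been mapped to
equal or opposite points with probability at least `n / (n + 1)`. -/
def absorptionTime (n : ℕ) : ℕ :=
  (exists_pow_lt_of_lt_one (y := 1 - absorptionProb n) (Nat.one_div_pos_of_nat (n := n) (α := ℝ))
    (sub_lt_self 1 absorptionProb_pos)).choose

lemma pow_absorptionTime_lt (n : ℕ) :
    (1 - absorptionProb n) ^ absorptionTime n < 1 / ((n : ℝ) + 1) :=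
  (exists_pow_lt_of_lt_one (y := 1 - absorptionProb n) (Nat.one_div_pos_of_nat (n := n) (α := ℝ))
    (sub_lt_self 1 absorptionProb_pos)).choose_spec

lemma pow_distOp_indicator_Ioo_le (hρ : ρ < 1) (hT : absorptionTime n ≤ T) (d : Fin (n + 1)) :
    (distOp n ρ ^ T) ((Set.Ioo 0 (Fin.last n)).indicator 1) d ≤ 1 / ((n : ℝ) + 1) := by
  have hc : 0 ≤ 1 - absorptionProb n := sub_nonneg.2 absorptionProb_le_one
  calc (distOp n ρ ^ T) ((Set.Ioo 0 (Fin.last n)).indicator 1) d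
      ≤ (1 - absorptionProb n) ^ T * (Set.Ioo 0 (Fin.last n)).indicator 1 d :=
        isMarkov_distOp.pow_apply_le_smul hc (distOp_indicator_Ioo_le hρ) T d
    _ ≤ (1 - absorptionProb n) ^ T * 1 :=
        mul_le_mul_of_nonneg_left (Set.indicator_le_self' (fun _ _ => zero_le_one) d)
          (pow_nonneg hc T)
    _ ≤ (1 - absorptionProb n) ^ absorptionTime n := by
        rw [mul_one]
        exact pow_le_pow_of_le_one hc (sub_le_self 1 absorptionProb_pos.le) hT
    _ ≤ 1 / ((n : ℝ) + 1) := (pow_absorptionTime_lt n).le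

/-- The correlation of an odd Boolean function at two points at distance `0` or `n`, extended by
zero to all other distances. -/
def absorbSign (n : ℕ) (d : Fin (n + 1)) : ℝ :=
  ({0} : Set (Fin (n + 1))).indicator 1 d - ({0} : Set (Fin (n + 1))).indicator 1 d.rev

lemma antitone_absorbSign : Antitone (absorbSign n) := by
  have hzero : Antitone (({0} : Set (Fin (n + 1))).indicator (1 : Fin (n + 1) → ℝ)) :=
    antitone_indicator antitone_const zero_le_one fun d e hed (hd : d = 0) =>
      Fin.le_zero_iff.1 (hed.trans_eq hd)
  exact fun d e hde => sub_le_sub (hzero hde) (hzero (Fin.rev_le_rev.2 hde))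

lemma absorbSign_rev (d : Fin (n + 1)) : absorbSign n d.rev = -absorbSign n d := by
  rw [absorbSign, absorbSign, Fin.rev_rev, neg_sub]

lemma absorbSign_le_one : absorbSign n ≤ 1 := fun d => by
  simp only [absorbSign, Set.indicator_apply, Pi.one_apply]
  split_ifs <;> norm_num

lemma cubeDist_eq_zero {x y : Cube n} : cubeDist x y = 0 ↔ x = y := by
  rw [← hammingDist_eq_zero]
  exact Fin.ext_iff

lemma rev_cubeDist_eq_zero {x y : Cube n} : (cubeDist x y).rev = 0 ↔ x = -y := by
  rw [← cubeDist_neg_right, cubeDist_eq_zero]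

lemma abs_pairProd_sub_absorbSign_le (hn : 0 < n) {h : Cube n → ℤˣ} (hh : Function.Odd h)
    (p : Cube n × Cube n) :
    |pairProd h p - absorbSign n (cubeDist p.1 p.2)| ≤
      (Set.Ioo 0 (Fin.last n)).indicator 1 (cubeDist p.1 p.2) := by
  have hlast : Fin.last n ≠ 0 := fun h0 => hn.ne' (congrArg Fin.val h0)
  by_cases hzero : cubeDist p.1 p.2 = 0
  · have hprod : pairProd h p = 1 := by
      rw [pairProd, cubeDist_eq_zero.1 hzero, realOf_mul_self]
    simp [hzero, hprod, absorbSign, hlast]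
  by_cases hrev : (cubeDist p.1 p.2).rev = 0
  · have hprod : pairProd h p = -1 := by
      rw [pairProd, rev_cubeDist_eq_zero.1 hrev, odd_realOf hh, neg_mul, realOf_mul_self]
    have hdist : cubeDist p.1 p.2 = Fin.last n := by rwa [Fin.rev_eq_iff, Fin.rev_zero] at hrev
    simp [hdist, hprod, absorbSign, hlast]
  have hmem : cubeDist p.1 p.2 ∈ Set.Ioo 0 (Fin.last n) :=
    ⟨Fin.pos_iff_ne_zero.2 hzero, Fin.lt_last_iff_ne_last.2 fun hd => hrev (by simp [hd])⟩
  simp [hmem, hzero, hrev, absorbSign, abs_pairProd]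

lemma abs_pairCorr_le_of_absorptionTime_le (hρ : ρ < 1) {h : Cube n → ℤˣ} (hh : Function.Odd h)
    (hT : absorptionTime n ≤ T) {x y : Cube n} (hxy : y ≠ x) (hxy' : y ≠ -x) :
    |pairCorr ρ T h x y| ≤
      survival (distOp n ρ) (lowerHalf n) (T - 1) 1 + 1 / ((n : ℝ) + 1) := by
  have hn := pos_of_ne hxy
  rw [pairCorr_eq]
  refine (abs_pow_pairOp_le hρ antitone_absorbSign absorbSign_rev absorbSign_le_one
    (abs_pairProd_sub_absorbSign_le hn hh) T hxy hxy').trans (add_le_add ?_ ?_)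
  · exact isMarkov_distOp.survival_antitone_time (Nat.sub_le T 1) 1
  · exact (congrFun (pow_pairOp_comp_cubeDist hn T _) (x, y)).trans_le
      (pow_distOp_indicator_Ioo_le hρ hT _)

end Absorption

section SignCorrelation

variable {n : ℕ}

section RandomSigns

variable {Ω : Type*} [MeasurableSpace Ω] {μ : Measure Ω} [IsProbabilityMeasure μ]
  {U V U' V' : Ω → ℤˣ}

lemma integral_mul_eq_one_sub (hU : Measurable U) (hV : Measurable V) :
    ∫ ω, ((U ω : ℤ) : ℝ) * ((V ω : ℤ) : ℝ) ∂μ = 1 - 2 * μ.real {ω | U ω ≠ V ω} := by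
  have hne : MeasurableSet {ω | U ω ≠ V ω} := (measurableSet_eq_fun hU hV).compl
  have hmul (ω : Ω) : ((U ω : ℤ) : ℝ) * ((V ω : ℤ) : ℝ) =
      1 - 2 * {ω | U ω ≠ V ω}.indicator (1 : Ω → ℝ) ω := by
    rcases Int.units_eq_one_or (U ω) with hu | hu <;>
      rcases Int.units_eq_one_or (V ω) with hv | hv <;>
      norm_num [Set.indicator_apply, hu, hv]
  have hint : Integrable ({ω | U ω ≠ V ω}.indicator (1 : Ω → ℝ)) μ :=
    (integrable_const 1).indicator hne
  simp_rw [hmul]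
  rw [integral_sub (integrable_const 1) (hint.const_mul 2), integral_const_mul,
    integral_indicator_one hne, integral_const, probReal_univ, one_smul]

lemma measureReal_ne_le_add :
    μ.real {ω | U ω ≠ V ω} ≤ μ.real {ω | U' ω ≠ V' ω} +
      (μ.real {ω | U ω ≠ U' ω} + μ.real {ω | V ω ≠ V' ω}) := by
  have hsub : {ω | U ω ≠ V ω} ⊆
      {ω | U' ω ≠ V' ω} ∪ ({ω | U ω ≠ U' ω} ∪ {ω | V ω ≠ V' ω}) := fun ω h => by
    by_contra! hω
    simp only [Set.mem_union, Set.mem_ofPred_eq, not_or, not_not] at hω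
    exact h (hω.2.1.trans (hω.1.trans hω.2.2.symm))
  refine (measureReal_mono hsub).trans ((measureReal_union_le _ _).trans ?_)
  gcongr
  exact measureReal_union_le _ _

lemma abs_measureReal_ne_sub_le :
    |μ.real {ω | U ω ≠ V ω} - μ.real {ω | U' ω ≠ V' ω}| ≤
      μ.real {ω | U ω ≠ U' ω} + μ.real {ω | V ω ≠ V' ω} := by
  have hle := measureReal_ne_le_add (μ := μ) (U := U) (V := V) (U' := U') (V' := V')
  have hge := measureReal_ne_le_add (μ := μ) (U := U') (V := V') (U' := U) (V' := V)
  rw [show {ω | U' ω ≠ U ω} = {ω | U ω ≠ U' ω} from Set.ext fun _ => ne_comm,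
    show {ω | V' ω ≠ V ω} = {ω | V ω ≠ V' ω} from Set.ext fun _ => ne_comm] at hge
  rw [abs_sub_le_iff]
  constructor <;> linarith

end RandomSigns

/-- The correlation of the signs of the inner products of a Gaussian vector with two points of the
cube at distance `d`. -/
def signCorr (n : ℕ) (d : Fin (n + 1)) : ℝ := 1 - 2 * gauss2.real (crossing (d / n))

lemma antitone_signCorr : Antitone (signCorr n) := fun d e hde => by
  have : gauss2.real (crossing (d / n)) ≤ gauss2.real (crossing (e / n)) :=
    measureReal_mono (crossing_mono (by positivity) (by gcongr; exact_mod_cast hde))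
  unfold signCorr
  linarith

lemma signCorr_le_one : signCorr n ≤ 1 := fun _ =>
  sub_le_self 1 (mul_nonneg zero_le_two measureReal_nonneg)

lemma measureReal_sgn_dotCLM_ne (hn : 0 < n) (x y : Cube n) :
    (stdGaussianPi (Fin n)).real {v | sgn (dotCLM (toReal x) v) ≠ sgn (dotCLM (toReal y) v)} =
      gauss2.real (crossing (cubeDist x y / n)) := by
  have hn' : 0 < √(n : ℝ) := by positivity
  have hdiscord := congrArg (fun μ => μ.real discord) (map_dotCLM_prod_eq_map_correlate hn x y)
  simp only [map_measureReal_apply (ContinuousLinearMap.measurable _) measurableSet_discord]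
    at hdiscord
  refine hdiscord.trans (congrArg gauss2.real ?_)
  ext z
  exact smul_mem_discord hn' _

lemma integral_sgn_dotCLM_mul (hn : 0 < n) (x y : Cube n) :
    ∫ v, ((sgn (dotCLM (toReal x) v) : ℤ) : ℝ) * ((sgn (dotCLM (toReal y) v) : ℤ) : ℝ)
      ∂stdGaussianPi (Fin n) = signCorr n (cubeDist x y) := by
  rw [integral_mul_eq_one_sub (by fun_prop) (by fun_prop), measureReal_sgn_dotCLM_ne hn, signCorr]

lemma ae_dotCLM_ne_zero (hn : 0 < n) (x : Cube n) :
    ∀ᵐ v ∂stdGaussianPi (Fin n), dotCLM (toReal x) v ≠ 0 := by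
  have := nullSingletonClass_gaussianReal (μ := 0) one_ne_zero
  refine ae_of_ae_map (f := dotCLM (toReal x)) (p := (· ≠ 0)) (by fun_prop) ?_
  rw [map_dotCLM_stdGaussianPi, sum_toReal_sq]
  refine (ae_map_iff (by fun_prop) (measurableSet_singleton 0).compl).2 ?_
  filter_upwards [Measure.ae_ne (gaussianReal 0 1) 0] with g hg
  exact mul_ne_zero (by positivity) hg

lemma signCorr_rev (hn : 0 < n) (d : Fin (n + 1)) : signCorr n d.rev = -signCorr n d := by
  obtain ⟨x, y, rfl⟩ := exists_cubeDist_eq d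
  rw [← cubeDist_neg_right, ← integral_sgn_dotCLM_mul hn, ← integral_sgn_dotCLM_mul hn,
    ← integral_neg]
  refine integral_congr_ae ?_
  filter_upwards [ae_dotCLM_ne_zero hn y] with v hv
  simp [toReal_neg, dotCLM_neg, sgn_neg hv]

end SignCorrelation

section NeuronBias

variable {ρ δ ε : ℝ}

lemma gaussianReal_Iic_neg (s : ℝ) :
    (gaussianReal 0 1).real (Set.Iic (-s)) = (gaussianReal 0 1).real (Set.Ici s) := by
  conv_rhs => rw [← neg_zero, ← gaussianReal_map_neg,
    map_measureReal_apply measurable_neg measurableSet_Ici]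
  congr 1
  ext x
  simp

lemma gaussianReal_Ici {s : ℝ} (hs : 0 < s) :
    (gaussianReal 0 1).real (Set.Ici s) =
      1 / 2 - (gaussianReal 0 1).real (Metric.ball 0 s) / 2 := by
  have hcompl : (Metric.ball (0 : ℝ) s)ᶜ = Set.Iic (-s) ∪ Set.Ici s := by
    rw [Real.ball_eq_Ioo, ← Set.Ioi_inter_Iio, Set.compl_inter, Set.compl_Ioi, Set.compl_Iio,
      zero_sub, zero_add]
  have hdisj : Disjoint (Set.Iic (-s)) (Set.Ici s) := Set.Iic_disjoint_Ici.2 (by linarith)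
  have hsum := probReal_compl_eq_one_sub (μ := gaussianReal 0 1)
    (measurableSet_ball (x := 0) (ε := s))
  rw [hcompl, measureReal_union hdisj measurableSet_Ici, gaussianReal_Iic_neg] at hsum
  linarith

lemma gaussianReal_Ici_neg {s : ℝ} (hs : 0 < s) :
    (gaussianReal 0 1).real (Set.Ici (-s)) =
      1 / 2 + (gaussianReal 0 1).real (Metric.ball 0 s) / 2 := by
  have := nullSingletonClass_gaussianReal (μ := 0) one_ne_zero
  have hsum := probReal_compl_eq_one_sub (μ := gaussianReal 0 1)
    (measurableSet_Iic (a := -s))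
  rw [Set.compl_Iic, measureReal_congr Ioi_ae_eq_Ici, gaussianReal_Iic_neg, gaussianReal_Ici hs]
    at hsum
  linarith

lemma gaussianReal_ball_pos {s : ℝ} (hs : 0 < s) :
    0 < (gaussianReal 0 1).real (Metric.ball 0 s) :=
  calc (0 : ℝ) < min s 1 / 2 * Real.exp (-(|0| + 1) ^ 2 / 2) := by positivity
    _ ≤ (gaussianReal 0 1).real (Metric.ball 0 (min s 1)) :=
      mul_exp_le_gaussianReal_ball 0 (by positivity) (min_le_right s 1)
    _ ≤ (gaussianReal 0 1).real (Metric.ball 0 s) :=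
      measureReal_mono (Metric.ball_subset_ball (min_le_left s 1))

/-- The probability that a neuron is `1`, given the normalized inner product `c` of its input with
the common noise. -/
def neuronBias (ρ c : ℝ) : ℝ := (shiftLaw ρ (gaussianReal 0 1) c).real (Set.Ici 0)

lemma neuronBias_eq (hρ : ρ < 1) (c : ℝ) :
    neuronBias ρ c = (gaussianReal 0 1).real (Set.Ici (-(noiseRatio ρ * c))) := by
  have hs : 0 < √(1 - ρ) := Real.sqrt_pos.2 (sub_pos.2 hρ)
  rw [neuronBias, shiftLaw_real _ measurableSet_Ici]
  congr 1
  ext g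
  have hfactor : √ρ • c + √(1 - ρ) • g = √(1 - ρ) * (noiseRatio ρ * c + g) := by
    simp only [noiseRatio, smul_eq_mul]
    field_simp
  rw [Set.mem_ofPred_eq, hfactor, Set.mem_Ici, mul_nonneg_iff_of_pos_left hs, Set.mem_Ici,
    neg_le_iff_add_nonneg']

lemma sqrt_le_noiseRatio (hδ : 0 < δ) (hδρ : δ ≤ ρ) (hρ : ρ < 1) : √δ ≤ noiseRatio ρ := by
  have hs : 0 < √(1 - ρ) := Real.sqrt_pos.2 (sub_pos.2 hρ)
  rw [noiseRatio, le_div_iff₀ hs]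
  exact (mul_le_of_le_one_right (Real.sqrt_nonneg δ) (Real.sqrt_le_one.2 (by linarith))).trans
    (Real.sqrt_le_sqrt hδρ)

lemma sgn_neuronBias_sub_half (hρ0 : 0 < ρ) (hρ : ρ < 1) {c : ℝ} (hc : c ≠ 0) :
    sgn (neuronBias ρ c - 1 / 2) = sgn c := by
  have hratio : 0 < noiseRatio ρ :=
    (Real.sqrt_pos.2 hρ0).trans_le (sqrt_le_noiseRatio hρ0 le_rfl hρ)
  rcases hc.lt_or_gt with hc | hc
  · have hs : 0 < -(noiseRatio ρ * c) := by nlinarith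
    rw [neuronBias_eq hρ, gaussianReal_Ici hs, sgn_of_neg hc, sgn_of_neg]
    linarith [gaussianReal_ball_pos hs]
  · have hs : 0 < noiseRatio ρ * c := by positivity
    rw [neuronBias_eq hρ, gaussianReal_Ici_neg hs, sgn_of_nonneg hc.le, sgn_of_nonneg]
    linarith [gaussianReal_ball_pos hs]

lemma le_abs_neuronBias_sub_half (hδ : 0 < δ) (hδρ : δ ≤ ρ) (hρ : ρ < 1) {r c : ℝ} (hr : 0 < r)
    (hc : r ≤ |c|) :
    (gaussianReal 0 1).real (Metric.ball 0 (√δ * r)) / 2 ≤ |neuronBias ρ c - 1 / 2| := by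
  have : 0 < √δ := Real.sqrt_pos.2 hδ
  have hratio : √δ ≤ noiseRatio ρ := sqrt_le_noiseRatio hδ hδρ hρ
  have hball {s : ℝ} (hs : √δ * r ≤ s) :
      (gaussianReal 0 1).real (Metric.ball 0 (√δ * r)) ≤
        (gaussianReal 0 1).real (Metric.ball 0 s) :=
    measureReal_mono (Metric.ball_subset_ball hs)
  rw [neuronBias_eq hρ]
  rcases le_abs.1 hc with hc | hc
  · have hle : √δ * r ≤ noiseRatio ρ * c := mul_le_mul hratio hc hr.le noiseRatio_nonneg
    have hs : 0 < noiseRatio ρ * c := (by positivity : 0 < √δ * r).trans_le hle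
    rw [gaussianReal_Ici_neg hs]
    exact le_trans (by linarith [hball hle]) (le_abs_self _)
  · have hle : √δ * r ≤ noiseRatio ρ * -c := mul_le_mul hratio hc hr.le noiseRatio_nonneg
    have hs : 0 < -(noiseRatio ρ * c) := by
      rw [← mul_neg]
      exact (by positivity : 0 < √δ * r).trans_le hle
    rw [gaussianReal_Ici hs]
    rw [mul_neg] at hle
    exact le_trans (by linarith [hball hle]) (neg_le_abs _)

end NeuronBias

section ConditionalLayerLaw

variable {n : ℕ} {ρ : ℝ}

/-- The law on `{-1, 1}` that gives probability `p` to `1`. -/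
def signLaw (p : ℝ) : Measure ℤˣ :=
  ENNReal.ofReal p • Measure.dirac (1 : ℤˣ) + ENNReal.ofReal (1 - p) • Measure.dirac (-1 : ℤˣ)

lemma isProbabilityMeasure_signLaw {p : ℝ} (h0 : 0 ≤ p) (h1 : p ≤ 1) :
    IsProbabilityMeasure (signLaw p) := by
  refine ⟨?_⟩
  simp only [signLaw, Measure.add_apply, Measure.smul_apply, measure_univ, smul_eq_mul, mul_one]
  rw [← ENNReal.ofReal_add h0 (sub_nonneg.2 h1), add_sub_cancel, ENNReal.ofReal_one]

lemma isProbabilityMeasure_biasedLaw {p : ℝ} (h0 : 0 ≤ p) (h1 : p ≤ 1) :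
    IsProbabilityMeasure (biasedLaw n p) :=
  have := isProbabilityMeasure_signLaw h0 h1
  inferInstanceAs (IsProbabilityMeasure (Measure.pi fun _ : Fin n => signLaw p))

lemma map_sgn (μ : Measure ℝ) [IsProbabilityMeasure μ] :
    μ.map sgn = signLaw (μ.real (Set.Ici 0)) := by
  have hpos : sgn ⁻¹' {1} = Set.Ici 0 := by
    ext u
    by_cases hu : 0 ≤ u <;> simp [sgn, hu]
  have hneg : sgn ⁻¹' {-1} = (Set.Ici 0)ᶜ := by
    ext u
    rcases le_or_gt 0 u with hu | hu
    · simp [sgn, hu]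
    · simp [sgn, hu, hu.not_ge]
  refine Measure.ext_of_singleton fun u => ?_
  rw [Measure.map_apply measurable_sgn (measurableSet_singleton u)]
  rcases Int.units_eq_one_or u with rfl | rfl
  · simp [signLaw, hpos]
  · rw [hneg, ← ofReal_measureReal, probReal_compl_eq_one_sub measurableSet_Ici]
    simp [signLaw]

lemma map_shiftLaw {E F : Type*} [AddCommGroup E] [Module ℝ E] [MeasurableSpace E]
    [MeasurableAdd₂ E] [MeasurableConstSMul ℝ E] [AddCommGroup F] [Module ℝ F] [MeasurableSpace F]
    [MeasurableAdd₂ F] [MeasurableConstSMul ℝ F] {μ : Measure E} {ℓ : E →ₗ[ℝ] F}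
    (hℓ : Measurable ℓ) (ν : E) : (shiftLaw ρ μ ν).map ℓ = shiftLaw ρ (μ.map ℓ) (ℓ ν) := by
  rw [shiftLaw, shiftLaw, Measure.map_map hℓ (by fun_prop), Measure.map_map (by fun_prop) hℓ]
  congr 1
  ext ψ
  simp

lemma map_sgn_dotCLM_shiftLaw (hn : 0 < n) (ν : Fin n → ℝ) (x : Cube n) :
    (shiftLaw ρ (stdGaussianPi (Fin n)) ν).map (fun w => sgn (dotCLM (toReal x) w)) =
      signLaw (neuronBias ρ (dotCLM (toReal x) ν / √(n : ℝ))) := by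
  have hn' : 0 < √(n : ℝ) := by positivity
  set c := dotCLM (toReal x) ν / √(n : ℝ)
  have hdot : (shiftLaw ρ (stdGaussianPi (Fin n)) ν).map (dotCLM (toReal x)) =
      (shiftLaw ρ (gaussianReal 0 1) c).map (√(n : ℝ) * ·) := by
    have hscale := map_shiftLaw (ρ := ρ) (μ := gaussianReal 0 1)
      (ℓ := LinearMap.mulLeft ℝ √(n : ℝ)) (measurable_const_mul _) c
    have hν : LinearMap.mulLeft ℝ √(n : ℝ) c = dotCLM (toReal x) ν := mul_div_cancel₀ _ hn'.ne'
    have hgauss := map_dotCLM_stdGaussianPi (toReal x)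
    rw [sum_toReal_sq] at hgauss
    rw [hν] at hscale
    refine (map_shiftLaw (ℓ := (dotCLM (toReal x)).toLinearMap) (by fun_prop) ν).trans ?_
    exact (congrArg (fun μ => shiftLaw ρ μ (dotCLM (toReal x) ν)) hgauss).trans hscale.symm
  calc (shiftLaw ρ (stdGaussianPi (Fin n)) ν).map (fun w => sgn (dotCLM (toReal x) w))
      = ((shiftLaw ρ (gaussianReal 0 1) c).map (√(n : ℝ) * ·)).map sgn := by
        rw [← hdot, Measure.map_map measurable_sgn (by fun_prop)]
        rfl
    _ = (shiftLaw ρ (gaussianReal 0 1) c).map sgn := by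
        rw [Measure.map_map measurable_sgn (by fun_prop)]
        simp only [Function.comp_def, sgn_mul_of_pos hn']
    _ = signLaw (neuronBias ρ c) := map_sgn _

lemma map_layer_pi_shiftLaw (hn : 0 < n) (ν : Fin n → ℝ) (x : Cube n) :
    (Measure.pi fun _ : Fin n => shiftLaw ρ (stdGaussianPi (Fin n)) ν).map (fun W => layer W x) =
      biasedLaw n (neuronBias ρ (dotCLM (toReal x) ν / √(n : ℝ))) := by
  have hsign := map_sgn_dotCLM_shiftLaw (ρ := ρ) hn ν x
  have : IsProbabilityMeasure ((shiftLaw ρ (stdGaussianPi (Fin n)) ν).map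
      fun w => sgn (dotCLM (toReal x) w)) :=
    Measure.isProbabilityMeasure_map (Measurable.aemeasurable (by fun_prop))
  rw [biasedLaw, ← signLaw, ← hsign,
    ← Measure.pi_map_pi fun _ => Measurable.aemeasurable (by fun_prop)]
  simp only [← layer_apply]

end ConditionalLayerLaw

section SharpThreshold

variable {n T : ℕ} {ρ δ ε : ℝ}

lemma HasSharpThreshold.eventually_biasedLaw_ne_le {h : ∀ n : ℕ, Cube n → ℤˣ}
    (hh : HasSharpThreshold h) {γ : ℝ} (hγ : 0 < γ) (hε : 0 < ε) :
    ∀ᶠ n : ℕ in atTop, ∀ p : ℝ, 0 ≤ p → p ≤ 1 → γ ≤ |p - 1 / 2| →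
      (biasedLaw n p).real {x | h n x ≠ sgn (p - 1 / 2)} ≤ ε := by
  rcases lt_or_ge (1 / 2) γ with hγ' | hγ'
  · refine Eventually.of_forall fun n p hp0 hp1 hp => absurd hp (not_le.2 ?_)
    exact (abs_le.2 ⟨by linarith, by linarith⟩).trans_lt hγ'
  let admissible (p : ℝ) : Prop := (0 ≤ p ∧ p ≤ 1) ∧ γ ≤ |p - 1 / 2|
  let bad (n : ℕ) (p : ℝ) : Prop :=
    admissible p ∧ ε < (biasedLaw n p).real {x | h n x ≠ sgn (p - 1 / 2)}
  -- At every `n` a worst admissible bias, and `1` where there is none.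
  have hworst (n : ℕ) : ∃ p, admissible p ∧ ∀ q, bad n q → bad n p := by
    by_cases hbad : ∃ q, bad n q
    · obtain ⟨q, hq⟩ := hbad
      exact ⟨q, hq.1, fun _ _ => hq⟩
    · refine ⟨1, ⟨⟨zero_le_one, le_rfl⟩, ?_⟩, fun q hq => absurd ⟨q, hq⟩ hbad⟩
      norm_num [hγ']
  choose p hp hbad using hworst
  have hlim := hh p (fun n => (hp n).1) ⟨γ, hγ, fun n => (hp n).2⟩
  filter_upwards [hlim.eventually (lt_mem_nhds (sub_lt_self 1 hε))] with n hn q hq0 hq1 hq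
  by_contra! hlt
  have := isProbabilityMeasure_biasedLaw (n := n) (hp n).1.1 (hp n).1.2
  have hcompl := probReal_compl_eq_one_sub (μ := biasedLaw n (p n))
    (Set.toFinite {x | h n x = sgn (p n - 1 / 2)}).measurableSet
  have hgt : ε < (biasedLaw n (p n)).real {x | h n x = sgn (p n - 1 / 2)}ᶜ :=
    (hbad n q ⟨⟨⟨hq0, hq1⟩, hq⟩, hlt⟩).2
  linarith

/-- The law of the common and the individual noises in a layer. -/
def layerNoise (n : ℕ) : Measure ((Fin n → ℝ) × (Fin n → Fin n → ℝ)) :=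
  (stdGaussianPi (Fin n)).prod (Measure.pi fun _ : Fin n => stdGaussianPi (Fin n))

instance : IsProbabilityMeasure (layerNoise n) :=
  inferInstanceAs (IsProbabilityMeasure (Measure.prod _ _))

/-- The weights of a layer as a function of the noises. -/
def noisyWeights (ρ : ℝ) (ξ : (Fin n → ℝ) × (Fin n → Fin n → ℝ)) : Fin n → Fin n → ℝ :=
  fun i => √ρ • ξ.1 + √(1 - ρ) • ξ.2 i

@[fun_prop]
lemma measurable_noisyWeights :
    Measurable (noisyWeights ρ : (Fin n → ℝ) × (Fin n → Fin n → ℝ) → _) := by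
  unfold noisyWeights
  fun_prop

lemma stdGaussianPi_abs_dotCLM_lt_le (hn : 0 < n) (x : Cube n) {r : ℝ} (hr : 0 ≤ r) :
    (stdGaussianPi (Fin n)).real {ν | r ≤ |dotCLM (toReal x) ν / √(n : ℝ)|}ᶜ ≤ 2 * r := by
  have hn' : 0 < √(n : ℝ) := by positivity
  have hball : {ν | r ≤ |dotCLM (toReal x) ν / √(n : ℝ)|}ᶜ =
      (fun ν => dotCLM (toReal x) ν / √(n : ℝ)) ⁻¹' Metric.ball 0 r := by
    ext ν
    simp [abs_div]
  have hmap : (stdGaussianPi (Fin n)).map (fun ν => dotCLM (toReal x) ν / √(n : ℝ)) =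
      gaussianReal 0 1 := by
    have hdot := map_dotCLM_stdGaussianPi (toReal x)
    rw [sum_toReal_sq] at hdot
    change (stdGaussianPi (Fin n)).map ((· / √(n : ℝ)) ∘ dotCLM (toReal x)) = _
    rw [← Measure.map_map (by fun_prop) (by fun_prop), hdot,
      Measure.map_map (by fun_prop) (by fun_prop)]
    simp only [Function.comp_def, mul_div_cancel_left₀ _ hn'.ne', Measure.map_id']
  rw [hball, ← map_measureReal_apply (by fun_prop) measurableSet_ball, hmap]
  exact gaussianReal_ball_le hr

lemma HasSharpThreshold.eventually_layerNoise_ne_le {h : ∀ n : ℕ, Cube n → ℤˣ}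
    (hh : HasSharpThreshold h) (hδ : 0 < δ) (hε : 0 < ε) :
    ∀ᶠ n : ℕ in atTop, ∀ ρ : ℝ, δ < ρ → ρ < 1 → ∀ x : Cube n,
      (layerNoise n).real {ξ | h n (layer (noisyWeights ρ ξ) x) ≠ sgn (dotCLM (toReal x) ξ.1)} ≤
        ε := by
  have hr : 0 < ε / 4 := by positivity
  have hgap := half_pos (gaussianReal_ball_pos (mul_pos (Real.sqrt_pos.2 hδ) hr))
  filter_upwards [hh.eventually_biasedLaw_ne_le hgap (half_pos hε), eventually_gt_atTop 0]
    with n hbias hn ρ hδρ hρ x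
  have hn' : 0 < √(n : ℝ) := by positivity
  have hS : MeasurableSet {ξ : (Fin n → ℝ) × (Fin n → Fin n → ℝ) |
      h n (layer (noisyWeights ρ ξ) x) ≠ sgn (dotCLM (toReal x) ξ.1)} :=
    (measurableSet_eq_fun ((measurable_of_finite (h n)).comp
      ((measurable_layer x).comp measurable_noisyWeights)) (by fun_prop)).compl
  have hZ : MeasurableSet {ν : Fin n → ℝ | ε / 4 ≤ |dotCLM (toReal x) ν / √(n : ℝ)|} :=
    measurableSet_le measurable_const (by fun_prop)
  refine (prod_real_le hS hZ (half_pos hε).le fun ν hν => ?_).trans ?_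
  · set c := dotCLM (toReal x) ν / √(n : ℝ)
    have hc0 : c ≠ 0 := abs_pos.1 (hr.trans_le hν)
    have hsgn : sgn (neuronBias ρ c - 1 / 2) = sgn (dotCLM (toReal x) ν) := by
      rw [sgn_neuronBias_sub_half (hδ.trans hδρ) hρ hc0, ← sgn_mul_of_pos hn',
        mul_div_cancel₀ _ hn'.ne']
    have hle := hbias (neuronBias ρ c) measureReal_nonneg measureReal_le_one
      (le_abs_neuronBias_sub_half hδ hδρ.le hρ hr hν)
    rw [hsgn, ← map_layer_pi_shiftLaw hn, ← map_pi_eq_pi_shiftLaw,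
      Measure.map_map (measurable_layer x) (by fun_prop),
      map_measureReal_apply ((measurable_layer x).comp (by fun_prop))
        (Set.toFinite _).measurableSet] at hle
    exact hle
  · linarith [stdGaussianPi_abs_dotCLM_lt_le hn x hr.le]

lemma abs_pairOp_pairProd_sub_signCorr_le (hn : 0 < n) {h : Cube n → ℤˣ}
    (hne : ∀ x : Cube n,
      (layerNoise n).real {ξ | h (layer (noisyWeights ρ ξ) x) ≠ sgn (dotCLM (toReal x) ξ.1)} ≤ ε)
    (p : Cube n × Cube n) :
    |pairOp n ρ (pairProd h) p - signCorr n (cubeDist p.1 p.2)| ≤ 4 * ε := by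
  let U (x : Cube n) (ξ : (Fin n → ℝ) × (Fin n → Fin n → ℝ)) : ℤˣ :=
    h (layer (noisyWeights ρ ξ) x)
  let S (x : Cube n) (ξ : (Fin n → ℝ) × (Fin n → Fin n → ℝ)) : ℤˣ := sgn (dotCLM (toReal x) ξ.1)
  have hU (x : Cube n) : Measurable (U x) :=
    (measurable_of_finite h).comp ((measurable_layer x).comp measurable_noisyWeights)
  have hpair : pairOp n ρ (pairProd h) p = 1 - 2 * (layerNoise n).real {ξ | U p.1 ξ ≠ U p.2 ξ} := by
    rw [← integral_mul_eq_one_sub (hU p.1) (hU p.2)]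
    exact integral_map measurable_noisyWeights.aemeasurable
      ((measurable_of_finite (pairProd h)).comp (by fun_prop :
        Measurable fun W : Fin n → Fin n → ℝ => (layer W p.1, layer W p.2))).aestronglyMeasurable
  have hsign : signCorr n (cubeDist p.1 p.2) =
      1 - 2 * (layerNoise n).real {ξ | S p.1 ξ ≠ S p.2 ξ} := by
    rw [← integral_mul_eq_one_sub (by fun_prop) (by fun_prop), ← integral_sgn_dotCLM_mul hn]
    simp only [layerNoise, S]
    rw [integral_fun_fst (μ := stdGaussianPi (Fin n)) (f := fun v =>
      ((sgn (dotCLM (toReal p.1) v) : ℤ) : ℝ) * ((sgn (dotCLM (toReal p.2) v) : ℤ) : ℝ)),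
      probReal_univ, one_smul]
  have hdiff := abs_measureReal_ne_sub_le (μ := layerNoise n) (U := U p.1) (V := U p.2)
    (U' := S p.1) (V' := S p.2)
  rw [hpair, hsign]
  rw [abs_le] at hdiff ⊢
  constructor <;> linarith [hne p.1, hne p.2]

lemma HasSharpThreshold.eventually_abs_pairCorr_le {h : ∀ n : ℕ, Cube n → ℤˣ}
    (hh : HasSharpThreshold h) (hδ : 0 < δ) (hε : 0 < ε) :
    ∀ᶠ n : ℕ in atTop, ∀ (ρ : ℝ) (T : ℕ), δ < ρ → ρ < 1 → 0 < T → ∀ x y : Cube n, y ≠ x → y ≠ -x →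
      |pairCorr ρ T (h n) x y| ≤ survival (distOp n ρ) (lowerHalf n) (T - 1) 1 + ε := by
  filter_upwards [hh.eventually_layerNoise_ne_le hδ (ε := ε / 4) (by positivity),
    eventually_gt_atTop 0] with n hne hn ρ T hδρ hρ hT x y hxy hxy'
  obtain ⟨t, rfl⟩ := Nat.exists_eq_succ_of_ne_zero hT.ne'
  have happrox := abs_pairOp_pairProd_sub_signCorr_le hn (hne ρ hδρ hρ)
  rw [mul_div_cancel₀ _ four_ne_zero] at happrox
  have hle := abs_pow_pairOp_le hρ antitone_signCorr (signCorr_rev hn) signCorr_le_one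
    (u := fun _ => ε) happrox t hxy hxy'
  rwa [(isMarkov_pairOp.pow t).map_const, ← Module.End.mul_apply, ← pow_succ, ← pairCorr_eq] at hle

end SharpThreshold

section Covariance

variable {n T : ℕ} {ρ ε : ℝ} {h : Cube n → ℤˣ}

lemma covariance_eq_integral_mul {Ω : Type*} [MeasurableSpace Ω] {μ : Measure Ω} {X Y : Ω → ℝ}
    (hX : ∫ ω, X ω ∂μ = 0) (hY : ∫ ω, Y ω ∂μ = 0) : cov[X, Y; μ] = ∫ ω, X ω * Y ω ∂μ := by
  simp only [covariance, hX, hY, sub_zero]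

lemma covariance_netReal (hρ : ρ < 1) (hh : Function.Odd h) (hT : 0 < T) (x y : Cube n) :
    cov[fun θ => netReal h θ x, fun θ => netReal h θ y; weightLaw n T ρ] =
      pairCorr ρ T h x y :=
  covariance_eq_integral_mul (integral_netReal hρ hh hT x) (integral_netReal hρ hh hT y)

lemma abs_netReal (h : Cube n → ℤˣ) (θ : Fin T → Fin n → Fin n → ℝ) (x : Cube n) :
    |netReal h θ x| = 1 := abs_realOf h (hiddenState T θ x)

@[fun_prop]
lemma measurable_netReal (h : Cube n → ℤˣ) (x : Cube n) :
    Measurable fun θ : Fin T → Fin n → Fin n → ℝ => netReal h θ x :=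
  (measurable_of_finite (realOf h)).comp (measurable_hiddenState x)

lemma integrable_netReal_mul_netReal (x y : Cube n) :
    Integrable (fun θ => netReal h θ x * netReal h θ y) (weightLaw n T ρ) :=
  Integrable.of_bound (by fun_prop) 1 <| ae_of_all _ fun θ => by
    rw [Real.norm_eq_abs, abs_mul, abs_netReal, abs_netReal, one_mul]

lemma measurable_netReal_uncurry (φ : Cube n × Cube n → Cube n) :
    Measurable fun z : (Cube n × Cube n) × (Fin T → Fin n → Fin n → ℝ) =>
      netReal h z.2 (φ z.1) :=
  measurable_from_prod_countable_right fun p => measurable_netReal h (φ p)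

lemma covariance_netReal_prod (hρ : ρ < 1) (hh : Function.Odd h) (hT : 0 < T)
    (Q : Measure (Cube n × Cube n)) [IsProbabilityMeasure Q] :
    cov[fun z => netReal h z.2 z.1.1, fun z => netReal h z.2 z.1.2; Q.prod (weightLaw n T ρ)] =
      ∫ p, pairCorr ρ T h p.1 p.2 ∂Q := by
  have hmean (φ : Cube n × Cube n → Cube n) :
      ∫ z, netReal h z.2 (φ z.1) ∂Q.prod (weightLaw n T ρ) = 0 := by
    have hint : Integrable (fun z => netReal h z.2 (φ z.1)) (Q.prod (weightLaw n T ρ)) :=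
      Integrable.of_bound (measurable_netReal_uncurry φ).aestronglyMeasurable 1
        (ae_of_all _ fun z => (abs_netReal _ _ _).le)
    simp only [integral_prod _ hint, integral_netReal hρ hh hT, integral_zero]
  rw [covariance_eq_integral_mul (hmean Prod.fst) (hmean Prod.snd)]
  have hmeas := (measurable_netReal_uncurry (h := h) (T := T) Prod.fst).mul
    (measurable_netReal_uncurry (h := h) (T := T) Prod.snd)
  refine integral_prod _ (Integrable.of_bound hmeas.aestronglyMeasurable 1
    (ae_of_all _ fun z => ?_))
  rw [Real.norm_eq_abs, abs_mul, abs_netReal, abs_netReal, one_mul]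

lemma abs_integral_pairCorr_le (hε : 0 ≤ ε)
    (hpair : ∀ x y : Cube n, y ≠ x → y ≠ -x → |pairCorr ρ T h x y| ≤ ε)
    (Q : Measure (Cube n × Cube n)) [IsProbabilityMeasure Q] :
    |∫ p, pairCorr ρ T h p.1 p.2 ∂Q| ≤ Q.real {p | p.2 = p.1 ∨ p.2 = -p.1} + ε := by
  let S : Set (Cube n × Cube n) := {p | p.2 = p.1 ∨ p.2 = -p.1}
  have hS : MeasurableSet S := (Set.toFinite S).measurableSet
  have hbound (p : Cube n × Cube n) :
      |pairCorr ρ T h p.1 p.2| ≤ S.indicator (1 : Cube n × Cube n → ℝ) p + ε := by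
    by_cases hp : p ∈ S
    · rw [Set.indicator_of_mem hp]
      exact le_add_of_le_of_nonneg (abs_pairCorr_le_one h p.1 p.2) hε
    · rw [Set.indicator_of_notMem hp, zero_add]
      exact hpair p.1 p.2 (fun h => hp (.inl h)) (fun h => hp (.inr h))
  calc |∫ p, pairCorr ρ T h p.1 p.2 ∂Q|
      ≤ ∫ p, |pairCorr ρ T h p.1 p.2| ∂Q := abs_integral_le_integral_abs
    _ ≤ ∫ p, (S.indicator (1 : Cube n × Cube n → ℝ) p + ε) ∂Q :=
        integral_mono .of_finite .of_finite hbound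
    _ = Q.real S + ε := by
        rw [integral_add .of_finite .of_finite, integral_indicator_one hS, integral_const,
          probReal_univ, one_smul]

end Covariance

section FlipCount

variable {n T k : ℕ} {ρ ε γ : ℝ} {h : Cube n → ℤˣ}

/-- The Hamming sphere of radius `k` about `x`. -/
def sphere (x : Cube n) (k : ℕ) : Finset (Cube n) := Finset.univ.filter fun y => hammingDist x y = k

lemma card_sphere (x : Cube n) (k : ℕ) : (sphere x k).card = n.choose k := by
  have hcard : (Finset.powersetCard k (Finset.univ : Finset (Fin n))).card = n.choose k := by simp
  rw [← hcard]
  refine Finset.card_bij' (fun y _ => Finset.univ.filter fun i => x i ≠ y i)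
    (fun s _ i => if i ∈ s then -x i else x i) (fun y hy => ?_) (fun s hs => ?_) (fun y _ => ?_)
    (fun s _ => ?_)
  · exact Finset.mem_powersetCard.2 ⟨Finset.subset_univ _, (Finset.mem_filter.1 hy).2⟩
  · rw [sphere, Finset.mem_filter, ← (Finset.mem_powersetCard.1 hs).2, hammingDist]
    refine ⟨Finset.mem_univ _, congrArg Finset.card ?_⟩
    ext i
    by_cases hi : i ∈ s <;> simp [hi]
  · ext1 i
    rcases eq_or_ne (x i) (y i) with hi | hi
    · simp [hi]
    · simp [Int.units_ne_iff_eq_neg.1 hi]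
  · ext i
    by_cases hi : i ∈ s <;> simp [hi]

lemma le_choose (hk : 1 ≤ k) (hkn : k < n) : n ≤ n.choose k := by
  obtain ⟨j, rfl⟩ := Nat.exists_eq_add_of_le' hk
  induction n, hkn using Nat.le_induction with
  | base => rw [Nat.choose_succ_self_right]
  | succ m hm ih =>
    have hpos : 0 < m.choose j := Nat.choose_pos (by omega)
    rw [Nat.choose_succ_succ']
    omega

lemma netReal_mul_sum_sphere (h : Cube n → ℤˣ) (θ : Fin T → Fin n → Fin n → ℝ) (x : Cube n)
    (k : ℕ) :
    netReal h θ x * ∑ y ∈ sphere x k, netReal h θ y =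
      n.choose k - 2 * (flipCount h θ x k : ℝ) := by
  have hcount : (flipCount h θ x k : ℝ) =
      ∑ y ∈ sphere x k, if net h θ y ≠ net h θ x then (1 : ℝ) else 0 := by
    rw [flipCount, sphere, Finset.sum_boole, Finset.filter_filter]
  rw [hcount, ← card_sphere x k, Finset.mul_sum, Finset.mul_sum, Finset.cast_card,
    ← Finset.sum_sub_distrib]
  refine Finset.sum_congr rfl fun y _ => ?_
  rcases Int.units_eq_one_or (net h θ x) with hx | hx <;>
    rcases Int.units_eq_one_or (net h θ y) with hy | hy <;> norm_num [netReal, hx, hy]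

lemma sq_le_sq_sum_of_flipCount_notMem (hC : 0 < n.choose k) (hγ : 0 ≤ γ)
    {θ : Fin T → Fin n → Fin n → ℝ} {x : Cube n}
    (hM : (flipCount h θ x k : ℝ) / (n.choose k : ℝ) ∉ Set.Ioo ((1 - γ) / 2) ((1 + γ) / 2)) :
    (γ * n.choose k) ^ 2 ≤ (∑ y ∈ sphere x k, netReal h θ y) ^ 2 := by
  have hC' : (0 : ℝ) < n.choose k := by exact_mod_cast hC
  have habs : |(n.choose k : ℝ) - 2 * (flipCount h θ x k : ℝ)| =
      |∑ y ∈ sphere x k, netReal h θ y| := by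
    rw [← netReal_mul_sum_sphere, abs_mul, abs_netReal, one_mul]
  have hdev : γ * n.choose k ≤ |∑ y ∈ sphere x k, netReal h θ y| := by
    rw [← habs]
    by_contra! hlt
    obtain ⟨hlow, hhigh⟩ := abs_lt.1 hlt
    exact hM ⟨by rw [lt_div_iff₀ hC']; linarith, by rw [div_lt_iff₀ hC']; linarith⟩
  rw [← sq_abs (∑ y ∈ sphere x k, netReal h θ y)]
  gcongr

lemma sum_pairCorr_le (hε : 0 ≤ ε)
    (hpair : ∀ x y : Cube n, y ≠ x → y ≠ -x → |pairCorr ρ T h x y| ≤ ε) (s : Finset (Cube n))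
    (x : Cube n) : ∑ y ∈ s, pairCorr ρ T h x y ≤ 2 + s.card * ε := by
  have hterm (y : Cube n) :
      pairCorr ρ T h x y ≤ (if y = x then 1 else 0) + (if y = -x then 1 else 0) + ε := by
    have hone := (le_abs_self _).trans (abs_pairCorr_le_one (ρ := ρ) (T := T) h x y)
    by_cases hyx : y = x
    · rw [if_pos hyx]
      split_ifs <;> linarith
    by_cases hyx' : y = -x
    · rw [if_neg hyx, if_pos hyx']
      linarith
    · rw [if_neg hyx, if_neg hyx']
      linarith [(le_abs_self _).trans (hpair x y hyx hyx')]
  refine (Finset.sum_le_sum fun y _ => hterm y).trans ?_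
  rw [Finset.sum_add_distrib, Finset.sum_add_distrib, Finset.sum_ite_eq', Finset.sum_ite_eq',
    Finset.sum_const, nsmul_eq_mul]
  gcongr
  split_ifs <;> norm_num

lemma integral_sq_sum_netReal_le (hε : 0 ≤ ε)
    (hpair : ∀ x y : Cube n, y ≠ x → y ≠ -x → |pairCorr ρ T h x y| ≤ ε) (s : Finset (Cube n)) :
    ∫ θ, (∑ y ∈ s, netReal h θ y) ^ 2 ∂weightLaw n T ρ ≤ s.card * (2 + s.card * ε) :=
  calc ∫ θ, (∑ y ∈ s, netReal h θ y) ^ 2 ∂weightLaw n T ρ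
      = ∑ y ∈ s, ∑ z ∈ s, pairCorr ρ T h y z := by
        simp only [sq, Finset.sum_mul_sum]
        rw [integral_finsetSum _ fun y _ =>
          integrable_finsetSum _ fun z _ => integrable_netReal_mul_netReal y z]
        refine Finset.sum_congr rfl fun y _ => ?_
        exact integral_finsetSum _ fun z _ => integrable_netReal_mul_netReal y z
    _ ≤ s.card * (2 + s.card * ε) := by
        rw [← nsmul_eq_mul]
        exact Finset.sum_le_card_nsmul _ _ _ fun y _ => sum_pairCorr_le hε hpair s y

lemma weightLaw_flipCount_notMem_le (hε : 0 ≤ ε) (hγ : 0 < γ)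
    (hpair : ∀ x y : Cube n, y ≠ x → y ≠ -x → |pairCorr ρ T h x y| ≤ ε) (x : Cube n)
    (hk : 1 ≤ k) (hkn : k < n) :
    (weightLaw n T ρ).real {θ | (flipCount h θ x k : ℝ) / (n.choose k : ℝ) ∉
      Set.Ioo ((1 - γ) / 2) ((1 + γ) / 2)} ≤ (2 / n + ε) / γ ^ 2 := by
  have hn : (0 : ℝ) < n := by exact_mod_cast (by omega : 0 < n)
  have hC : (n : ℝ) ≤ n.choose k := by exact_mod_cast le_choose hk hkn
  have hC0 : (0 : ℝ) < n.choose k := hn.trans_le hC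
  have hint : Integrable (fun θ => (∑ y ∈ sphere x k, netReal h θ y) ^ 2) (weightLaw n T ρ) := by
    simp only [sq, Finset.sum_mul_sum]
    exact integrable_finsetSum _ fun y _ =>
      integrable_finsetSum _ fun z _ => integrable_netReal_mul_netReal y z
  have hsecond := integral_sq_sum_netReal_le hε hpair (sphere x k)
  rw [card_sphere] at hsecond
  have hchebyshev := mul_meas_ge_le_integral_of_nonneg (ae_of_all _ fun θ => sq_nonneg _) hint
    ((γ * n.choose k) ^ 2)
  calc (weightLaw n T ρ).real {θ | (flipCount h θ x k : ℝ) / (n.choose k : ℝ) ∉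
        Set.Ioo ((1 - γ) / 2) ((1 + γ) / 2)}
      ≤ (weightLaw n T ρ).real
          {θ | (γ * n.choose k) ^ 2 ≤ (∑ y ∈ sphere x k, netReal h θ y) ^ 2} :=
        measureReal_mono fun θ hθ => by
          exact sq_le_sq_sum_of_flipCount_notMem (by exact_mod_cast hC0) hγ.le hθ
    _ ≤ n.choose k * (2 + n.choose k * ε) / (γ * n.choose k) ^ 2 := by
        rw [le_div_iff₀ (by positivity), mul_comm]
        exact hchebyshev.trans hsecond
    _ = (2 / n.choose k + ε) / γ ^ 2 := by field_simp
    _ ≤ (2 / n + ε) / γ ^ 2 := by gcongr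

end FlipCount

section Limits

/-- The outputs of the networks at two inputs that are neither equal nor opposite are
asymptotically uncorrelated, uniformly in the inputs. -/
def AsymptoticallyUncorrelated (ρ : ℕ → ℝ) (T : ℕ → ℕ) (h : ∀ n : ℕ, Cube n → ℤˣ) : Prop :=
  ∀ ε > 0, ∀ᶠ n : ℕ in atTop, ∀ x y : Cube n, y ≠ x → y ≠ -x →
    |pairCorr (ρ n) (T n) (h n) x y| ≤ ε

variable {δ γ : ℝ} {ρ : ℕ → ℝ} {T : ℕ → ℕ} {h : ∀ n : ℕ, Cube n → ℤˣ}

lemma asymptoticallyUncorrelated (hδ : 0 < δ)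
    (hρ : ∀ᶠ n : ℕ in atTop, δ < ρ n ∧ ρ n < 1 - 4 * Real.log (Real.log n) ^ 3 / Real.log n)
    (hρ1 : ∀ᶠ n in atTop, ρ n < 1)
    (hT : ∀ᶠ n : ℕ in atTop, Real.exp (4 * Real.log (Real.log n) ^ 2) ≤ (T n : ℝ))
    (hT0 : ∀ᶠ n in atTop, 0 < T n) (hodd : ∀ᶠ n in atTop, Function.Odd (h n))
    (hcase : HasSharpThreshold h ∨ ∀ᶠ n in atTop, absorptionTime n ≤ T n) :
    AsymptoticallyUncorrelated ρ T h := by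
  intro ε hε
  have hsurvival :=
    (tendsto_survival_distOp hδ hρ hT).eventually (gt_mem_nhds (half_pos hε))
  rcases hcase with hsharp | habsorb
  · filter_upwards [hsurvival, hsharp.eventually_abs_pairCorr_le hδ (half_pos hε), hρ, hρ1, hT0]
      with n hn hcorr hδρ hρ1 hT0 x y hxy hxy'
    linarith [hcorr (ρ n) (T n) hδρ.1 hρ1 hT0 x y hxy hxy']
  · have hsmall : ∀ᶠ n : ℕ in atTop, 1 / ((n : ℝ) + 1) < ε / 2 :=
      tendsto_one_div_add_atTop_nhds_zero_nat.eventually (gt_mem_nhds (half_pos hε))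
    filter_upwards [hsurvival, habsorb, hρ1, hodd, hsmall]
      with n hn hT hρ1 hodd hsmall x y hxy hxy'
    linarith [abs_pairCorr_le_of_absorptionTime_le hρ1 hodd hT hxy hxy']

namespace AsymptoticallyUncorrelated

lemma tendsto_covariance (hcorr : AsymptoticallyUncorrelated ρ T h)
    (hρ : ∀ᶠ n in atTop, ρ n < 1) (hT : ∀ᶠ n in atTop, 0 < T n)
    (hodd : ∀ᶠ n in atTop, Function.Odd (h n)) {x y : ∀ n : ℕ, Cube n}
    (hxy : ∀ᶠ n in atTop, y n ≠ x n ∧ y n ≠ -x n) :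
    Tendsto (fun n => cov[fun θ => netReal (h n) θ (x n), fun θ => netReal (h n) θ (y n);
      weightLaw n (T n) (ρ n)]) atTop (𝓝 0) := by
  refine Metric.tendsto_nhds.2 fun ε hε => ?_
  filter_upwards [hcorr (ε / 2) (half_pos hε), hρ, hT, hodd, hxy] with n hle hρ hT hodd hxy
  rw [Real.dist_0_eq_abs, covariance_netReal hρ hodd hT]
  exact (hle _ _ hxy.1 hxy.2).trans_lt (half_lt_self hε)

lemma tendsto_covariance_prod (hcorr : AsymptoticallyUncorrelated ρ T h)
    (hρ : ∀ᶠ n in atTop, ρ n < 1) (hT : ∀ᶠ n in atTop, 0 < T n)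
    (hodd : ∀ᶠ n in atTop, Function.Odd (h n)) {Q : ∀ n : ℕ, Measure (Cube n × Cube n)}
    [∀ n, IsProbabilityMeasure (Q n)]
    (hQ : Tendsto (fun n => (Q n).real {p | p.2 = p.1 ∨ p.2 = -p.1}) atTop (𝓝 0)) :
    Tendsto (fun n => cov[fun z => netReal (h n) z.2 z.1.1, fun z => netReal (h n) z.2 z.1.2;
      (Q n).prod (weightLaw n (T n) (ρ n))]) atTop (𝓝 0) := by
  refine Metric.tendsto_nhds.2 fun ε hε => ?_
  filter_upwards [hcorr (ε / 2) (half_pos hε), hQ.eventually (gt_mem_nhds (half_pos hε)), hρ, hT,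
    hodd] with n hle hQ hρ hT hodd
  rw [Real.dist_0_eq_abs, covariance_netReal_prod hρ hodd hT]
  linarith [abs_integral_pairCorr_le (half_pos hε).le hle (Q n)]

lemma tendsto_flipCount_notMem (hcorr : AsymptoticallyUncorrelated ρ T h) {k : ℕ → ℕ}
    (hk : ∀ᶠ n in atTop, 1 ≤ k n ∧ k n ≤ n - 1) (x : ∀ n : ℕ, Cube n) (hγ : 0 < γ) :
    Tendsto (fun n => (weightLaw n (T n) (ρ n)).real
      {θ | (flipCount (h n) θ (x n) (k n) : ℝ) / (n.choose (k n) : ℝ) ∉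
        Set.Ioo ((1 - γ) / 2) ((1 + γ) / 2)}) atTop (𝓝 0) := by
  refine Metric.tendsto_nhds.2 fun ε hε => ?_
  have hε' : 0 < ε * γ ^ 2 / 2 := by positivity
  filter_upwards [hcorr _ hε', hk,
    (tendsto_const_div_atTop_nhds_zero_nat 2).eventually (gt_mem_nhds hε')] with n hle hk hn
  rw [Real.dist_0_eq_abs, abs_of_nonneg measureReal_nonneg]
  refine (weightLaw_flipCount_notMem_le hε'.le hγ hle (x n) hk.1 (by omega)).trans_lt ?_
  rw [div_lt_iff₀ (by positivity)]
  linarith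

end AsymptoticallyUncorrelated

lemma eventually_lt_one_of_lt_one_sub
    (hρ : ∀ᶠ n : ℕ in atTop, ρ n < 1 - 4 * Real.log (Real.log n) ^ 3 / Real.log n) :
    ∀ᶠ n in atTop, ρ n < 1 := by
  have hlog : Tendsto (fun n : ℕ => Real.log n) atTop atTop :=
    Real.tendsto_log_atTop.comp tendsto_natCast_atTop_atTop
  filter_upwards [hρ, hlog.eventually_ge_atTop 1] with n hρ hlog
  have hloglog : 0 ≤ Real.log (Real.log n) := Real.log_nonneg hlog
  exact hρ.trans_le (sub_le_self 1 (by positivity))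

end Limits

end BoolNet

end

theorem mainTheorem5 :
    ∃ S : ℕ → ℕ,
      ∀ (δ : ℝ) (ρ : ℕ → ℝ) (T : ℕ → ℕ) (h : ∀ n : ℕ, BoolNet.Cube n → ℤˣ),
        0 < δ →
        (∀ᶠ n : ℕ in atTop,
          δ < ρ n ∧ ρ n < 1 - 4 * Real.log (Real.log n) ^ 3 / Real.log n) →
        (∀ᶠ n : ℕ in atTop, Real.exp (4 * Real.log (Real.log n) ^ 2) ≤ (T n : ℝ)) →
        (∀ᶠ n : ℕ in atTop, Function.Odd (h n)) →
        (BoolNet.HasSharpThreshold h ∨ ∀ᶠ n : ℕ in atTop, S n ≤ T n) →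
        -- (i) fixed pairs of inputs
        (∀ ω η : ∀ n : ℕ, BoolNet.Cube n,
          (∀ᶠ n : ℕ in atTop, η n ≠ ω n ∧ η n ≠ -ω n) →
          Tendsto
            (fun n => cov[fun θ => BoolNet.netReal (h n) θ (ω n),
              fun θ => BoolNet.netReal (h n) θ (η n); BoolNet.weightLaw n (T n) (ρ n)])
            atTop (𝓝 0)) ∧
        -- (ii) random pairs of inputs, independent of the weights
        (∀ Q : ∀ n : ℕ, Measure (BoolNet.Cube n × BoolNet.Cube n),
          (∀ n, IsProbabilityMeasure (Q n)) →
          Tendsto (fun n => (Q n).real {p | p.2 = p.1 ∨ p.2 = -p.1}) atTop (𝓝 0) →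
          Tendsto
            (fun n => cov[fun z => BoolNet.netReal (h n) z.2 z.1.1,
              fun z => BoolNet.netReal (h n) z.2 z.1.2;
              (Q n).prod (BoolNet.weightLaw n (T n) (ρ n))])
            atTop (𝓝 0)) ∧
        -- (iii) the fraction of neighbours at distance `k` with the other output
        (∀ (k : ℕ → ℕ) (ω : ∀ n : ℕ, BoolNet.Cube n) (γ : ℝ),
          (∀ᶠ n : ℕ in atTop, 1 ≤ k n ∧ k n ≤ n - 1) → 0 < γ →
          Tendsto
            (fun n => (BoolNet.weightLaw n (T n) (ρ n)).real
              {θ | (BoolNet.flipCount (h n) θ (ω n) (k n) : ℝ) / (n.choose (k n) : ℝ) ∉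
                Set.Ioo ((1 - γ) / 2) ((1 + γ) / 2)})
            atTop (𝓝 0)) := by
  refine ⟨BoolNet.absorptionTime, fun δ ρ T h hδ hρ hT hodd hcase => ?_⟩
  have hρ1 : ∀ᶠ n in atTop, ρ n < 1 :=
    BoolNet.eventually_lt_one_of_lt_one_sub (hρ.mono fun _ h => h.2)
  have hT0 : ∀ᶠ n in atTop, 0 < T n :=
    hT.mono fun _ h => Nat.cast_pos.1 ((Real.exp_pos _).trans_le h)
  have hcorr := BoolNet.asymptoticallyUncorrelated hδ hρ hρ1 hT hT0 hodd hcase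
  exact ⟨fun ω η hne => hcorr.tendsto_covariance hρ1 hT0 hodd hne,
    fun Q _ hQ => hcorr.tendsto_covariance_prod hρ1 hT0 hodd hQ,
    fun k ω γ hk hγ => hcorr.tendsto_flipCount_notMem hk ω hγ⟩
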